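/- **Theorem 4.1 (MAP inference for $k$-DPPs via greedy and local search).** Let $A\in\mathbb{R}^{m\times n}$ have rows $a_1,\dots,a_m$, let $1\le k\le m$ and $\varepsilon>0$. For $S\subseteq[m]$ let $A_S$ be the submatrix of the rows indexed by $S$, let $\lambda_1\ge\dots\ge\lambda_m$ be the eigenvalues of $AA^T$, and put $$\kappa(A)=\frac{\lambda_1}{\frac{1}{m-k+1}\sum_{t=k}^{m}\lambda_t}$$ (the denominator is positive if and only if $k\le\operatorname{rank}A$; if $k>\operatorname{rank}A$ then all the determinants below vanish, and the value of $\kappa(A)$ is irrelevant). Consider the following algorithm. Greedy initialization: start with $S=\emptyset$ and, in $k$ steps, add an element $i\notin S$ that maximizes $\det(A_{S\cup\{i\}}A_{S\cup\{i\}}^T)$. Local search: as long as some swap $S\to S'=S\setminus\{i\}\cup\{j\}$ with $i\in S$, $j\notin S$ satisfies $\det(A_{S'}A_{S'}^T)>(1+\varepsilon/k)\det(A_SA_S^T)$, replace $S$ by $S'$ for a swap that maximizes $\det(A_{S'}A_{S'}^T)$. Ties are broken in any way. Then the following hold. 1. The algorithm always stops, after at most $C\,k^2\log k/\min\{\varepsilon,k\}$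 local search steps, where $C$ is an absolute constant; for $\varepsilon\le k$ this is $O(k^2\log k/\varepsilon)$. 2. Every possible final set $S$ has $|S|=k$ and $$\max_{|T|=k}\det(A_TA_T^T)\le 2^{k\log_2\min\{k,\kappa(A)\}}\det(A_SA_S^T).$$ 3. If $\lambda_m>0$, then $\kappa(A)\le\lambda_1/\lambda_m$, the condition number of $AA^T$. 4. The algorithm can be run in time linear in the number $\operatorname{nnz}(A)$ of non-zero entries of $A$: on a random access machine with exact real arithmetic at unit cost there is one program that, for all $m,n,A,k,\varepsilon$ with $1\le k\le\operatorname{rank}A$ and $\varepsilon>0$, given $k$, $\varepsilon$ and the list of the non-zero entries of $A$ with their positions (in any order), outputs a possible final set $S$ of the algorithm after at most $C\,k^{d}\,(1+1/\varepsilon)\operatorname{nnz}(A)$ operations, with absolute constants $C,d$. -/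

import Mathlib

namespace MAPkDPP

/-! ## Determinants, eigenvalues, condition parameter -/

/-- `det (A_S A_Sᵀ)`, where `A_S` is the submatrix of `A` formed by the rows indexed by `S`. -/
noncomputable def detRows {m n : ℕ} (A : Matrix (Fin m) (Fin n) ℝ) (S : Finset (Fin m)) : ℝ :=
  ((A.submatrix (fun i : S => (i : Fin m)) id) *
    (A.submatrix (fun i : S => (i : Fin m)) id).transpose).det

theorem isHermitian_gram {m n : ℕ} (A : Matrix (Fin m) (Fin n) ℝ) :
    (A * A.transpose).IsHermitian := by
  simpa [Matrix.conjTranspose_eq_transpose_of_trivial] using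
    Matrix.isHermitian_mul_conjTranspose_self A

/-- `λ_t (A Aᵀ)`, the `t`-th largest eigenvalue (with multiplicity) of the `m × m` matrix `A Aᵀ`,
for `1 ≤ t ≤ m`; Mathlib's `eigenvalues₀` lists the eigenvalues in decreasing order from
position `0`. Outside `1 ≤ t ≤ m` the value is `0` and is not used. -/
noncomputable def lam {m n : ℕ} (A : Matrix (Fin m) (Fin n) ℝ) (t : ℕ) : ℝ :=
  if h : 1 ≤ t ∧ t ≤ m then
    (isHermitian_gram A).eigenvalues₀ ⟨t - 1, by rw [Fintype.card_fin]; omega⟩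
  else 0

/-- `κ(A) = λ₁ / ((1 / (m - k + 1)) ∑_{t ≥ k} λ_t)`, with `m` the number of rows of `A`, i.e. the
number of eigenvalues of `A Aᵀ`. The denominator is positive exactly when `k ≤ rank A`; if
`rank A < k` then all the determinants `det (A_S A_Sᵀ)`, `|S| = k`, vanish. -/
noncomputable def kappa {m n : ℕ} (A : Matrix (Fin m) (Fin n) ℝ) (k : ℕ) : ℝ :=
  lam A 1 / ((1 / ((m : ℝ) - (k : ℝ) + 1)) * ∑ t ∈ Finset.Icc k m, lam A t)

/-! ## Greedy initialization and local search (ties may be broken in any way) -/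

/-- `IsGreedy A t S`: the set `S` can be the current set of the greedy algorithm after `t` steps,
each of which adds an element maximizing the determinant. -/
inductive IsGreedy {m n : ℕ} (A : Matrix (Fin m) (Fin n) ℝ) : ℕ → Finset (Fin m) → Prop
  | start : IsGreedy A 0 ∅
  | step {t : ℕ} {S : Finset (Fin m)} {i : Fin m} (hS : IsGreedy A t S) (hi : i ∉ S)
      (hmax : ∀ j, j ∉ S → detRows A (insert j S) ≤ detRows A (insert i S)) :
      IsGreedy A (t + 1) (insert i S)

/-- The set `S \ {i} ∪ {j}`. -/
def swap {m : ℕ} (S : Finset (Fin m)) (i j : Fin m) : Finset (Fin m) :=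
  insert j (S.erase i)

/-- One local search step from `S` to `S'`: a best swap of some `i ∈ S` with some `j ∉ S`, which is
made only if it improves the determinant by a factor larger than `1 + ε / k`. -/
def SwapStep {m n : ℕ} (A : Matrix (Fin m) (Fin n) ℝ) (k : ℕ) (ε : ℝ)
    (S S' : Finset (Fin m)) : Prop :=
  ∃ i ∈ S, ∃ j, j ∉ S ∧ S' = swap S i j ∧
    (∀ i' ∈ S, ∀ j', j' ∉ S → detRows A (swap S i' j') ≤ detRows A (swap S i j)) ∧
    (1 + ε / (k : ℝ)) * detRows A S < detRows A (swap S i j)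

/-- `S 0, S 1, …, S N` is a (possibly unfinished) run of the algorithm: a greedy initialization
followed by `N` local search steps. -/
def IsRun {m n : ℕ} (A : Matrix (Fin m) (Fin n) ℝ) (k : ℕ) (ε : ℝ) (N : ℕ)
    (S : ℕ → Finset (Fin m)) : Prop :=
  IsGreedy A k (S 0) ∧ ∀ t < N, SwapStep A k ε (S t) (S (t + 1))

/-- The local search stops at `S`. -/
def Stops {m n : ℕ} (A : Matrix (Fin m) (Fin n) ℝ) (k : ℕ) (ε : ℝ) (S : Finset (Fin m)) : Prop :=
  ∀ S', ¬ SwapStep A k ε S S'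

/-- `S` is a result of the algorithm: the last set of a run that has stopped. -/
def IsResult {m n : ℕ} (A : Matrix (Fin m) (Fin n) ℝ) (k : ℕ) (ε : ℝ)
    (S : Finset (Fin m)) : Prop :=
  ∃ (N : ℕ) (R : ℕ → Finset (Fin m)), IsRun A k ε N R ∧ R N = S ∧ Stops A k ε S

/-! ## A real random access machine with a step count

Programs are finite texts of a small imperative language. The memory consists of arrays of natural
numbers (used for indices) and two-dimensional arrays of real numbers. Natural numbers can be added,
subtracted (truncated) and compared; real numbers can be added, subtracted, multiplied, divided
and compared, exactly and at unit cost. There is no rounding of reals to integers. -/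

/-- The memory: cell `i` of the natural array number `a` is `nat a i`; cell `(i, j)` of the real
array number `a` is `real a i j`. -/
structure Mem where
  nat : ℕ → ℕ → ℕ
  real : ℕ → ℕ → ℕ → ℝ

/-- Index expressions. The name `a` of an array is a constant of the program. -/
inductive NExpr where
  | const (c : ℕ)
  | get (a : ℕ) (i : NExpr)
  | add (x y : NExpr)
  | sub (x y : NExpr)

/-- Real expressions. -/
inductive RExpr where
  | ofNat (x : NExpr)
  | get (a : ℕ) (i j : NExpr)
  | add (x y : RExpr)
  | sub (x y : RExpr)
  | mul (x y : RExpr)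
  | div (x y : RExpr)

/-- Tests. -/
inductive Test where
  | natLt (x y : NExpr)
  | natEq (x y : NExpr)
  | realLt (x y : RExpr)
  | not (b : Test)
  | and (b c : Test)

/-- Programs. -/
inductive Prog where
  | skip
  | setNat (a : ℕ) (i : NExpr) (x : NExpr)
  | setReal (a : ℕ) (i j : NExpr) (x : RExpr)
  | seq (p q : Prog)
  | ite (b : Test) (p q : Prog)
  | loop (b : Test) (p : Prog)

/-- Value of an index expression. -/
def NExpr.eval (s : Mem) : NExpr → ℕ
  | .const c => c
  | .get a i => s.nat a (i.eval s)
  | .add x y => x.eval s + y.eval s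
  | .sub x y => x.eval s - y.eval s

/-- Number of operations needed to evaluate an index expression. -/
def NExpr.cost : NExpr → ℕ
  | .const _ => 1
  | .get _ i => i.cost + 1
  | .add x y => x.cost + y.cost + 1
  | .sub x y => x.cost + y.cost + 1

/-- Value of a real expression (a division by zero returns zero). -/
noncomputable def RExpr.eval (s : Mem) : RExpr → ℝ
  | .ofNat x => (x.eval s : ℝ)
  | .get a i j => s.real a (i.eval s) (j.eval s)
  | .add x y => x.eval s + y.eval s
  | .sub x y => x.eval s - y.eval s
  | .mul x y => x.eval s * y.eval s
  | .div x y => x.eval s / y.eval s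

/-- Number of operations needed to evaluate a real expression. -/
def RExpr.cost : RExpr → ℕ
  | .ofNat x => x.cost + 1
  | .get _ i j => i.cost + j.cost + 1
  | .add x y => x.cost + y.cost + 1
  | .sub x y => x.cost + y.cost + 1
  | .mul x y => x.cost + y.cost + 1
  | .div x y => x.cost + y.cost + 1

/-- The test succeeds. -/
def Test.Holds (s : Mem) : Test → Prop
  | .natLt x y => x.eval s < y.eval s
  | .natEq x y => x.eval s = y.eval s
  | .realLt x y => x.eval s < y.eval s
  | .not b => ¬ b.Holds s
  | .and b c => b.Holds s ∧ c.Holds s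

/-- Number of operations needed for a test. -/
def Test.cost : Test → ℕ
  | .natLt x y => x.cost + y.cost + 1
  | .natEq x y => x.cost + y.cost + 1
  | .realLt x y => x.cost + y.cost + 1
  | .not b => b.cost + 1
  | .and b c => b.cost + c.cost + 1

/-- Memory after writing `v` into cell `i` of the natural array `a`. -/
def Mem.writeNat (s : Mem) (a i v : ℕ) : Mem where
  nat := fun a' i' => if a' = a ∧ i' = i then v else s.nat a' i'
  real := s.real

/-- Memory after writing `v` into cell `(i, j)` of the real array `a`. -/
noncomputable def Mem.writeReal (s : Mem) (a i j : ℕ) (v : ℝ) : Mem where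
  nat := s.nat
  real := fun a' i' j' => if a' = a ∧ i' = i ∧ j' = j then v else s.real a' i' j'

/-- `Exec p s T s'`: started in memory `s`, the program `p` halts in memory `s'` after exactly `T`
operations. -/
inductive Exec : Prog → Mem → ℕ → Mem → Prop
  | skip (s : Mem) : Exec .skip s 1 s
  | setNat (s : Mem) (a : ℕ) (i x : NExpr) :
      Exec (.setNat a i x) s (i.cost + x.cost + 1) (s.writeNat a (i.eval s) (x.eval s))
  | setReal (s : Mem) (a : ℕ) (i j : NExpr) (x : RExpr) :
      Exec (.setReal a i j x) s (i.cost + j.cost + x.cost + 1)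
        (s.writeReal a (i.eval s) (j.eval s) (x.eval s))
  | seq {p q : Prog} {s s' s'' : Mem} {T T' : ℕ} (hp : Exec p s T s') (hq : Exec q s' T' s'') :
      Exec (.seq p q) s (T + T') s''
  | iteTrue {b : Test} {p q : Prog} {s s' : Mem} {T : ℕ} (hb : b.Holds s) (hp : Exec p s T s') :
      Exec (.ite b p q) s (b.cost + T) s'
  | iteFalse {b : Test} {p q : Prog} {s s' : Mem} {T : ℕ} (hb : ¬ b.Holds s)
      (hq : Exec q s T s') : Exec (.ite b p q) s (b.cost + T) s'
  | loopDone {b : Test} {p : Prog} {s : Mem} (hb : ¬ b.Holds s) : Exec (.loop b p) s b.cost s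
  | loopNext {b : Test} {p : Prog} {s s' s'' : Mem} {T T' : ℕ} (hb : b.Holds s)
      (hp : Exec p s T s') (hl : Exec (.loop b p) s' T' s'') :
      Exec (.loop b p) s (b.cost + T + T') s''

/-! ## Sparse input and output -/

/-- The positions of the non-zero entries of `A`. -/
abbrev Support {m n : ℕ} (A : Matrix (Fin m) (Fin n) ℝ) : Type :=
  {p : Fin m × Fin n // A p.1 p.2 ≠ 0}

/-- The number of non-zero entries of `A`. -/
noncomputable def nnz {m n : ℕ} (A : Matrix (Fin m) (Fin n) ℝ) : ℕ :=
  Nat.card (Support A)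

/-- The initial memory for the input `(A, k, ε)`, where `A` is given by the list of its non-zero
entries in the order `e`: natural array `0` holds `k`, `nnz A`, `m`, `n`; natural arrays `1` and `2`
hold the row and column indices of the non-zero entries, and column `0` of the real array `1` holds
their values; cell `(0, 0)` of the real array `0` holds `ε`. Every other cell is `0`. -/
noncomputable def input {m n : ℕ} (A : Matrix (Fin m) (Fin n) ℝ) (k : ℕ) (ε : ℝ)
    (e : Fin (nnz A) ≃ Support A) : Mem where
  nat := fun a p =>
    if a = 0 then
      (if p = 0 then k else if p = 1 then nnz A else if p = 2 then m else if p = 3 then n else 0)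
    else if a = 1 then (if h : p < nnz A then ((e ⟨p, h⟩).1.1 : ℕ) else 0)
    else if a = 2 then (if h : p < nnz A then ((e ⟨p, h⟩).1.2 : ℕ) else 0)
    else 0
  real := fun a p q =>
    if a = 0 then (if p = 0 ∧ q = 0 then ε else 0)
    else if a = 1 then
      (if h : p < nnz A ∧ q = 0 then A (e ⟨p, h.1⟩).1.1 (e ⟨p, h.1⟩).1.2 else 0)
    else 0

/-- The first `k` cells of the natural array `3` list the elements of the set `S`. -/
def Outputs {m : ℕ} (s : Mem) (k : ℕ) (S : Finset (Fin m)) : Prop :=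
  (∀ t < k, ∃ i ∈ S, s.nat 3 t = (i : ℕ)) ∧ ∀ i ∈ S, ∃ t < k, s.nat 3 t = (i : ℕ)

end MAPkDPP

set_option linter.unusedSectionVars false

/-! Put `L = A * Aᵀ`, so that `detRows A S` is a principal minor of a positive semidefinite matrix.
Adding an element to `S` multiplies this minor by a diagonal entry of the Schur complement
(`minor_union`). Hence greedy selection is Gaussian elimination with diagonal pivoting; the greedy
determinant is the product of the pivots, and the pivots decrease.

Factor `k ^ k` (`IsGreedyList.scaled`, `IsGreedyList.minor_le`): eliminating the first `k - 1`
pivots `pᵢ` writes `L` as a residual matrix plus rank-one terms `cᵢ cᵢᵀ` whose diagonal entries are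
at most `pᵢ`, by maximality of the pivots. Let `ρ` be the last, smallest pivot. Multiplying a
rank-one term by `ρ / pᵢ ≤ 1` lowers any principal minor by at most this factor, because the
determinant is affine in the coefficient of a rank-one term (`mul_det_le_det_sub`). The scaled
matrix has diagonal at most `k ρ`, so Hadamard's inequality bounds its `k × k` minors by `(k ρ) ^
k`; undoing the scaling leaves `k ^ k` times the product of all pivots.

Factor `κ ^ k` (`IsGreedy.pow_tailAvg_le`): after `k - 1` eliminations the residual matrix agrees
with `L` on a subspace of codimension at most `k - 1`, so its trace is at least `λ_k + … + λ_m`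
(`sum_tail_eigenvalues_le_trace`). Since `k - 1` of its diagonal entries vanish, the largest one,
which is the last pivot, is at least the average of these eigenvalues. On the other hand every `k ×
k` minor is at most `λ₁ ^ k`, again by Hadamard.

Local search only increases the determinant and so keeps both bounds. The first one also limits its
length (`IsRun.length_le`): each step gains a factor above `1 + ε / k`, and the total gain is at
most `k ^ k`.

Running time: one `scan` eliminates the selected rows except one and reads off, for every further
row, the determinant obtained by adding it. It touches only rows that have entries and takes `O(k²
nnz)` operations (`run_scan`). A greedy step is one scan, a local search step is `k` scans.
Correctness and cost are proved together in a small Hoare calculus (`Run`). -/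

namespace MAPkDPP

open Matrix

/-! ### Schur complements of one pivot and principal minors. -/

section Pivot

variable {ι : Type*} [Fintype ι] [DecidableEq ι]

/-- The principal minor of `M` on the index set `S`. -/
noncomputable def minor (M : Matrix ι ι ℝ) (S : Finset ι) : ℝ :=
  (M.submatrix (fun i : S => (i : ι)) (fun i : S => (i : ι))).det

/-- One step of symmetric Gaussian elimination: the Schur complement of the entry `(i, i)`, as a
matrix on the full index set. If the pivot vanishes, the matrix does not change. -/
noncomputable def pivot (Z : Matrix ι ι ℝ) (i : ι) : Matrix ι ι ℝ :=
  Z - (Z i i)⁻¹ • vecMulVec (Z i) (Z i)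

theorem pivot_apply (Z : Matrix ι ι ℝ) (i a b : ι) :
    pivot Z i a b = Z a b - (Z i i)⁻¹ * (Z i a * Z i b) := by
  simp [pivot, vecMulVec_apply]

theorem posSemidef_symm {Z : Matrix ι ι ℝ} (hZ : Z.PosSemidef) (a b : ι) : Z a b = Z b a := by
  have := hZ.1.apply b a
  simpa using this

theorem posSemidef_vecMulVec (c : ι → ℝ) : (vecMulVec c c).PosSemidef := by
  simpa using posSemidef_vecMulVec_self_star c

theorem posSemidef_sq_le {Z : Matrix ι ι ℝ} (hZ : Z.PosSemidef) (i j : ι) :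
    Z i j ^ 2 ≤ Z i i * Z j j := by
  have h := (hZ.submatrix ![i, j]).det_nonneg
  rw [det_fin_two] at h
  simp only [submatrix_apply, cons_val_zero, cons_val_one] at h
  rw [posSemidef_symm hZ j i] at h
  nlinarith

theorem posSemidef_row_eq_zero {Z : Matrix ι ι ℝ} (hZ : Z.PosSemidef) {i : ι} (hi : Z i i = 0)
    (j : ι) : Z i j = 0 := by
  have := posSemidef_sq_le hZ i j
  rw [hi, zero_mul] at this
  exact pow_eq_zero_iff (two_ne_zero) |>.1 (le_antisymm this (sq_nonneg _))

theorem pivot_posSemidef {Z : Matrix ι ι ℝ} (hZ : Z.PosSemidef) (i : ι) :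
    (pivot Z i).PosSemidef := by
  by_cases hi : Z i i = 0
  · simpa [pivot, hi] using hZ
  -- Elimination of `i` is a congruence of `Z`, by the identity minus a multiple of `e_i Z_i`.
  · have h := hZ.conjTranspose_mul_mul_same (1 - (Z i i)⁻¹ • vecMulVec (Pi.single i 1) (Z i))
    convert h using 1
    ext a b
    have e1 : ∀ a b, (Z * (1 - (Z i i)⁻¹ • vecMulVec (Pi.single i 1) (Z i))) a b =
        Z a b - (Z i i)⁻¹ * (Z a i * Z i b) := by
      intro a b
      rw [Matrix.mul_sub, Matrix.mul_one, Matrix.sub_apply, Matrix.mul_smul, Matrix.smul_apply,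
        mul_apply]
      simp [vecMulVec_apply, Pi.single_apply]
    rw [Matrix.mul_assoc, mul_apply, pivot_apply]
    simp only [e1]
    simp only [conjTranspose_apply, Matrix.sub_apply, Matrix.smul_apply, Matrix.one_apply, vecMulVec_apply,
      Pi.single_apply, star_trivial, smul_eq_mul]
    simp only [sub_mul, Finset.sum_sub_distrib, ite_mul, one_mul, zero_mul, mul_ite, mul_zero,
      Finset.sum_ite_eq', Finset.mem_univ, if_true]
    rw [posSemidef_symm hZ a i]
    field_simp
    ring

theorem pivot_apply_self {Z : Matrix ι ι ℝ} (hZ : Z.PosSemidef) (i b : ι) : pivot Z i i b = 0 := by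
  rw [pivot_apply]
  by_cases hi : Z i i = 0
  · simp [posSemidef_row_eq_zero hZ hi]
  · field_simp
    ring

theorem pivot_diag_le {Z : Matrix ι ι ℝ} (hZ : Z.PosSemidef) (i j : ι) :
    pivot Z i j j ≤ Z j j := by
  rw [pivot_apply]
  have := mul_nonneg (inv_nonneg.2 (hZ.diag_nonneg (i := i))) (mul_self_nonneg (Z i j))
  linarith

theorem minor_nonneg {Z : Matrix ι ι ℝ} (hZ : Z.PosSemidef) (S : Finset ι) : 0 ≤ minor Z S :=
  (hZ.submatrix _).det_nonneg

@[simp] theorem minor_empty (Z : Matrix ι ι ℝ) : minor Z ∅ = 1 := by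
  simp [minor]

/-- Elimination of one index divides every principal minor containing it by the pivot. -/
theorem minor_insert {Z : Matrix ι ι ℝ} (hZ : Z.PosSemidef) {i : ι} {U : Finset ι} (hi : i ∉ U) :
    minor Z (insert i U) = Z i i * minor (pivot Z i) U := by
  -- A zero pivot forces its whole row to vanish, so both sides are zero.
  by_cases h0 : Z i i = 0
  · rw [h0, zero_mul]
    exact det_eq_zero_of_row_eq_zero ⟨i, Finset.mem_insert_self i U⟩ fun j => by
      simp [posSemidef_row_eq_zero hZ h0]
  -- Place `i` last as a one-element block and use the Schur complement formula for block
  -- determinants.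
  · let e := ((Finset.subtypeInsertEquivOption hi).trans (Equiv.optionEquivSumPUnit U : Option U ≃ U ⊕ PUnit.{1})).symm
    have he1 : ∀ x : U, ((e (Sum.inl x)) : ι) = x := fun x => rfl
    have he2 : ((e (Sum.inr PUnit.unit)) : ι) = i := rfl
    let D : Matrix PUnit.{1} PUnit.{1} ℝ := of fun _ _ => Z i i
    have hD : D = diagonal fun _ => Z i i := by ext a b; simp [D]
    have : Invertible (Z i i) := invertibleOfNonzero h0
    have : Invertible D := by
      refine ⟨diagonal fun _ => (Z i i)⁻¹, ?_, ?_⟩ <;> rw [hD, diagonal_mul_diagonal] <;>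
        simp [h0]
    have hinv : ⅟D = diagonal fun _ => (Z i i)⁻¹ := by
      rw [invOf_eq_right_inv]; rw [hD, diagonal_mul_diagonal]; simp [h0]
    rw [minor, ← det_submatrix_equiv_self e]
    have : ((Z.submatrix (fun x : (insert i U : Finset ι) => (x : ι))
        (fun x : (insert i U : Finset ι) => (x : ι))).submatrix e e) =
        fromBlocks (Z.submatrix (fun x : U => (x : ι)) (fun x : U => (x : ι)))
          (of fun x _ => Z x i) (of fun _ x => Z i x) D := by
      ext a b
      rcases a with a | a <;> rcases b with b | b <;> simp [he1, he2, D]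
    rw [this, det_fromBlocks₂₂, minor, hinv]
    congr 1
    · rw [hD]; simp
    · congr 1
      ext a b
      simp [pivot_apply, mul_apply]
      rw [posSemidef_symm hZ a i]
      ring

theorem minor_singleton (Z : Matrix ι ι ℝ) (i : ι) : minor Z {i} = Z i i := by
  simp only [minor]
  rw [det_unique]
  rfl

/-- **Hadamard's inequality** for principal minors. -/
theorem minor_le_prod_diag {Z : Matrix ι ι ℝ} (hZ : Z.PosSemidef) (U : Finset ι) :
    minor Z U ≤ ∏ i ∈ U, Z i i := by
  induction U using Finset.induction_on generalizing Z with
  | empty => simp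
  | insert i U hi ih =>
    rw [minor_insert hZ hi, Finset.prod_insert hi]
    refine mul_le_mul_of_nonneg_left ((ih (pivot_posSemidef hZ i)).trans ?_) hZ.diag_nonneg
    exact Finset.prod_le_prod (fun j _ => (pivot_posSemidef hZ i).diag_nonneg)
      fun j _ => pivot_diag_le hZ i j

theorem minor_le_pow {Z : Matrix ι ι ℝ} (hZ : Z.PosSemidef) {b : ℝ} (hb : ∀ i, Z i i ≤ b)
    (U : Finset ι) : minor Z U ≤ b ^ U.card := by
  refine (minor_le_prod_diag hZ U).trans ?_
  rw [← Finset.prod_const]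
  exact Finset.prod_le_prod (fun j _ => hZ.diag_nonneg) fun j _ => hb j

/-- Subtracting a part of a rank-one matrix that fits below a positive semidefinite matrix. -/
theorem mul_det_le_det_sub {F : Matrix ι ι ℝ} (hF : F.PosSemidef) {c : ι → ℝ}
    (hc : (F - vecMulVec c c).PosSemidef) {x : ℝ} (hx0 : 0 ≤ x) (hx1 : x ≤ 1) :
    x * F.det ≤ (F - (1 - x) • vecMulVec c c).det := by
  by_cases h0 : F.det = 0
  · rw [h0, mul_zero]
    have : F - (1 - x) • vecMulVec c c = x • F + (1 - x) • (F - vecMulVec c c) := by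
      ext a b; simp; ring
    rw [this]
    exact ((hF.smul hx0).add (hc.smul (sub_nonneg.2 hx1))).det_nonneg
  · have hu : IsUnit F.det := isUnit_iff_ne_zero.2 h0
    -- By the matrix determinant lemma the determinant is affine in `s`. It equals `det F` at `s =
    -- 0` and is nonnegative at `s = 1`, so at `s = 1 - x` it is at least `x * det F`.
    have key : ∀ s : ℝ, (F - s • vecMulVec c c).det =
        F.det * (1 - s * (replicateRow Unit c * F⁻¹ * replicateCol Unit c).det) := by
      intro s
      have := det_add_replicateCol_mul_replicateRow (ι := Unit) hu (-s • c) c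
      rw [← vecMulVec_eq] at this
      have e : F - s • vecMulVec c c = F + vecMulVec (-s • c) c := by
        ext a b; simp [vecMulVec_apply]; ring
      rw [e, this]
      have e2 : replicateCol Unit (-s • c) = -s • replicateCol Unit c := by
        ext; simp
      rw [e2]
      simp only [neg_smul, Matrix.mul_neg, Matrix.mul_smul, det_unique, Matrix.add_apply, Matrix.neg_apply,
        Matrix.smul_apply, smul_eq_mul, Matrix.one_apply_eq]
      ring
    have h1 := hc.det_nonneg
    rw [← one_smul ℝ (vecMulVec c c), key 1] at h1
    rw [key]
    nlinarith

end Pivot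

/-! ### Iterated elimination, greedy pivoting and the factor `k ^ k`. -/

section Resid

variable {ι : Type*} [Fintype ι] [DecidableEq ι]

/-- The residual matrix after elimination of the indices of a list, the head being the last. -/
noncomputable def resid (L : Matrix ι ι ℝ) : List ι → Matrix ι ι ℝ
  | [] => L
  | i :: W => pivot (resid L W) i

/-- The product of the pivots. -/
noncomputable def pivotProd (L : Matrix ι ι ℝ) : List ι → ℝ
  | [] => 1
  | i :: W => resid L W i i * pivotProd L W

theorem resid_posSemidef {L : Matrix ι ι ℝ} (hL : L.PosSemidef) (W : List ι) :
    (resid L W).PosSemidef := by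
  induction W with
  | nil => exact hL
  | cons i W ih => exact pivot_posSemidef ih i

theorem pivotProd_nonneg {L : Matrix ι ι ℝ} (hL : L.PosSemidef) (W : List ι) :
    0 ≤ pivotProd L W := by
  induction W with
  | nil => simp [pivotProd]
  | cons i W ih => exact mul_nonneg (resid_posSemidef hL W).diag_nonneg ih

/-- The induction hands the last eliminated index over to `U` and applies `minor_insert` to the
residual matrix. -/
theorem minor_union {L : Matrix ι ι ℝ} (hL : L.PosSemidef) {W : List ι} (hW : W.Nodup)
    {U : Finset ι} (hU : ∀ i ∈ W, i ∉ U) :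
    minor L (W.toFinset ∪ U) = pivotProd L W * minor (resid L W) U := by
  induction W generalizing U with
  | nil => simp [pivotProd, resid]
  | cons i W ih =>
    rw [List.nodup_cons] at hW
    have e : (i :: W).toFinset ∪ U = W.toFinset ∪ insert i U := by
      ext; simp
    rw [e, ih hW.2, minor_insert (resid_posSemidef hL W) (hU i (by simp)), pivotProd, resid]
    · ring
    · intro j hj hjU
      rcases Finset.mem_insert.1 hjU with rfl | h
      · exact hW.1 hj
      · exact hU j (by simp [hj]) h

theorem minor_toFinset {L : Matrix ι ι ℝ} (hL : L.PosSemidef) {W : List ι} (hW : W.Nodup) :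
    minor L W.toFinset = pivotProd L W := by
  simpa using minor_union hL hW (U := ∅) (by simp)

theorem minor_insert_toFinset {L : Matrix ι ι ℝ} (hL : L.PosSemidef) {W : List ι} (hW : W.Nodup)
    {j : ι} (hj : j ∉ W) :
    minor L (insert j W.toFinset) = pivotProd L W * resid L W j j := by
  have := minor_union hL hW (U := {j}) (by rintro i hi h; simp at h; exact hj (h ▸ hi))
  rw [minor_singleton] at this
  rw [← this]
  congr 1
  ext; simp

/-- An eliminated row is zero at once, and later corrections are multiples of its own zero entries.
Hence maxima of the residual diagonal never select an index twice. -/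
theorem resid_apply_of_mem {L : Matrix ι ι ℝ} (hL : L.PosSemidef) {W : List ι} {j : ι}
    (hj : j ∈ W) (b : ι) : resid L W j b = 0 := by
  induction W generalizing b with
  | nil => simp at hj
  | cons i W ih =>
    rcases List.mem_cons.1 hj with rfl | h
    · exact pivot_apply_self (resid_posSemidef hL W) _ _
    · rw [resid, pivot_apply, ih h, posSemidef_symm (resid_posSemidef hL W) i j, ih h]
      ring

theorem resid_diag_le {L : Matrix ι ι ℝ} (hL : L.PosSemidef) (W : List ι) (j : ι) :
    resid L W j j ≤ L j j := by
  induction W with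
  | nil => exact le_rfl
  | cons i W ih => exact (pivot_diag_le (resid_posSemidef hL W) i j).trans ih

/-- Every pivot is a positive maximal diagonal entry of the current residual matrix. -/
def IsGreedyList (L : Matrix ι ι ℝ) : List ι → Prop
  | [] => True
  | i :: W => (∀ j, resid L W j j ≤ resid L W i i) ∧ 0 < resid L W i i ∧ IsGreedyList L W

/-- `F` is the residual matrix plus all the rank-one terms removed so far, each multiplied by `ρ`
over its pivot. Every scaled term then adds at most `ρ` to a diagonal entry, and costs at most the
factor `ρ / pivot` in each principal minor; the product of these factors is `ρ ^ W.length /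
pivotProd L W`. -/
theorem IsGreedyList.scaled {L : Matrix ι ι ℝ} (hL : L.PosSemidef) {W : List ι}
    (hW : IsGreedyList L W) {ρ : ℝ} (hρ : 0 ≤ ρ) (hle : ∀ i W', i :: W' <:+ W →
      ρ ≤ resid L W' i i) :
    ∃ F : Matrix ι ι ℝ, (F - resid L W).PosSemidef ∧
      (∀ j, F j j ≤ resid L W j j + W.length * ρ) ∧
      ∀ T, minor L T * ρ ^ W.length ≤ minor F T * pivotProd L W := by
  induction W with
  | nil => exact ⟨L, by simpa [resid] using PosSemidef.zero, by simp [resid], by simp [pivotProd]⟩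
  | cons i W ih =>
    obtain ⟨F, hF1, hF2, hF3⟩ := ih hW.2.2 fun i' W' h => hle i' W' (h.trans (List.suffix_cons _ _))
    obtain ⟨hmax, hpos, -⟩ := hW
    set Z := resid L W with hZdef
    have hZ : Z.PosSemidef := resid_posSemidef hL W
    have hρi : ρ ≤ Z i i := hle i W (List.suffix_refl _)
    set x := ρ / Z i i with hx
    have hx0 : 0 ≤ x := div_nonneg hρ hpos.le
    have hx1 : x ≤ 1 := (div_le_one hpos).2 hρi
    set c : ι → ℝ := fun j => Z i j / √(Z i i) with hc
    have hcc : vecMulVec c c = (Z i i)⁻¹ • vecMulVec (Z i) (Z i) := by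
      ext a b
      simp only [vecMulVec_apply, hc, Matrix.smul_apply, smul_eq_mul]
      rw [div_mul_div_comm, Real.mul_self_sqrt hpos.le]
      field_simp
    have hpiv : resid L (i :: W) = Z - vecMulVec c c := by
      rw [hcc]; rfl
    have hFpsd : F.PosSemidef := by simpa using hF1.add hZ
    have hFc : (F - vecMulVec c c).PosSemidef := by
      have := hF1.add (pivot_posSemidef hZ i)
      convert this using 1
      rw [hcc, pivot]; abel
    refine ⟨F - (1 - x) • vecMulVec c c, ?_, ?_, ?_⟩
    · have : F - (1 - x) • vecMulVec c c - resid L (i :: W) = (F - Z) + x • vecMulVec c c := by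
        rw [hpiv]; ext a b; simp; ring
      rw [this]
      exact hF1.add ((posSemidef_vecMulVec c).smul hx0)
    · intro j
      have h1 := hF2 j
      have h2 : c j * c j ≤ Z i i := by
        have h3 : c j * c j = Z i j ^ 2 / Z i i := by
          rw [hc]; simp only; rw [div_mul_div_comm, Real.mul_self_sqrt hpos.le, sq]
        rw [h3, div_le_iff₀ hpos]
        exact (posSemidef_sq_le hZ i j).trans (mul_le_mul_of_nonneg_left (hmax j) hpos.le)
      have h4 : x * (c j * c j) ≤ ρ := by
        have := mul_le_mul_of_nonneg_left h2 hx0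
        rwa [hx, div_mul_cancel₀ _ hpos.ne'] at this
      rw [hpiv]
      simp [vecMulVec_apply]
      linarith
    · intro T
      have h1 : x * minor F T ≤ minor (F - (1 - x) • vecMulVec c c) T := by
        refine mul_det_le_det_sub (c := fun i : T => c i) (hFpsd.submatrix _) ?_ hx0 hx1
        exact hFc.submatrix (fun i : T => (i : ι))
      have hp := pivotProd_nonneg hL W
      calc minor L T * ρ ^ (i :: W).length = (minor L T * ρ ^ W.length) * ρ := by
            simp [pow_succ]; ring
        _ ≤ (minor F T * pivotProd L W) * ρ := mul_le_mul_of_nonneg_right (hF3 T) hρ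
        _ = (x * minor F T) * (Z i i * pivotProd L W) := by
            rw [hx]; field_simp
        _ ≤ _ := mul_le_mul_of_nonneg_right h1 (mul_nonneg hpos.le hp)

/-- Elimination does not increase diagonal entries, and each pivot was maximal when chosen. Proper
suffixes of the list are earlier stages. -/
theorem IsGreedyList.pivot_antitone {L : Matrix ι ι ℝ} (hL : L.PosSemidef) {i : ι} {W : List ι}
    (hW : IsGreedyList L (i :: W)) {i' : ι} {W' : List ι} (h : i' :: W' <:+ i :: W) :
    resid L W i i ≤ resid L W' i' i' := by
  induction W generalizing i with
  | nil =>
    simp only [List.suffix_cons_iff, List.suffix_nil, reduceCtorEq, or_false, List.cons.injEq] at h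
    rw [h.1, h.2]
  | cons a W ih =>
    rcases List.suffix_cons_iff.1 h with h | h
    · simp only [List.cons.injEq] at h
      rw [h.1, h.2]
    · exact ((pivot_diag_le (resid_posSemidef hL W) a i).trans (hW.2.2.1 i)).trans (ih hW.2.2 h)

/-- Greedy pivoting approximates the maximal `k × k` principal minor up to the factor `k ^ k`. -/
theorem IsGreedyList.minor_le {L : Matrix ι ι ℝ} (hL : L.PosSemidef) {W : List ι}
    (hW : IsGreedyList L W) {T : Finset ι} (hT : T.card = W.length) :
    minor L T ≤ (W.length : ℝ) ^ W.length * pivotProd L W := by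
  cases W with
  | nil => simp at hT; simp [hT, pivotProd]
  | cons i W =>
    have hpos := hW.2.1
    set ρ := resid L W i i with hρ
    -- Only the pivots before the last are scaled, down to the last pivot `ρ`; the residual diagonal
    -- is itself at most `ρ`, so the diagonal of `F` is at most `(W.length + 1) * ρ`.
    obtain ⟨F, hF1, hF2, hF3⟩ := IsGreedyList.scaled hL hW.2.2 hpos.le fun i' W' h =>
      hW.pivot_antitone hL (h.trans (List.suffix_cons _ _))
    have hFpsd : F.PosSemidef := by simpa using hF1.add (resid_posSemidef hL W)
    have h1 := minor_le_pow hFpsd (b := (W.length + 1) * ρ) (fun j => by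
      have := hF2 j; have := hW.1 j; linarith) T
    rw [hT] at h1
    have hp := pivotProd_nonneg hL W
    have h2 := (hF3 T).trans (mul_le_mul_of_nonneg_right h1 hp)
    have h3 : 0 < ρ ^ W.length := pow_pos hpos _
    refine le_of_mul_le_mul_right (h2.trans (le_of_eq ?_)) h3
    simp only [List.length_cons, pivotProd, mul_pow, pow_succ, Nat.cast_add, Nat.cast_one, ← hρ]
    ring

theorem IsGreedyList.pow_le_pivotProd {L : Matrix ι ι ℝ} {W : List ι} {μ : ℝ} (hμ : 0 ≤ μ)
    (h : ∀ i W', i :: W' <:+ W → μ ≤ resid L W' i i) : μ ^ W.length ≤ pivotProd L W := by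
  induction W with
  | nil => simp [pivotProd]
  | cons i W ih =>
    rw [List.length_cons, pow_succ', pivotProd]
    have h1 := h i W (List.suffix_refl _)
    exact mul_le_mul h1 (ih fun i' W' h' => h i' W' (h'.trans (List.suffix_cons _ _)))
      (pow_nonneg hμ _) (hμ.trans h1)

end Resid

/-! ### Eigenvalues, traces and ranks of residual matrices. -/

section KyFan

variable {ι : Type*} [Fintype ι] [DecidableEq ι]

theorem dotProduct_mulVec_eq_sum {M : Matrix ι ι ℝ} (hM : M.IsHermitian)
    (v : EuclideanSpace ℝ ι) :
    v.ofLp ⬝ᵥ (M *ᵥ v.ofLp) =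
      ∑ i, hM.eigenvalues i * inner ℝ (hM.eigenvectorBasis i) v ^ 2 := by
  have h := hM.eigenvectorBasis.sum_inner_mul_inner v (WithLp.toLp 2 (M *ᵥ v.ofLp))
  have e : ∀ x y : EuclideanSpace ℝ ι, inner ℝ x y = x.ofLp ⬝ᵥ y.ofLp := fun x y => by
    rw [EuclideanSpace.inner_eq_star_dotProduct, star_trivial, dotProduct_comm]
  rw [e v] at h
  rw [← h]
  refine Finset.sum_congr rfl fun i _ => ?_
  rw [real_inner_comm]
  have : inner ℝ (hM.eigenvectorBasis i) (WithLp.toLp 2 (M *ᵥ v.ofLp)) =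
      hM.eigenvalues i * inner ℝ (hM.eigenvectorBasis i) v := by
    rw [e, e]
    have hs : Mᵀ = M := by
      have := hM.eq
      rwa [conjTranspose_eq_transpose_of_trivial] at this
    rw [dotProduct_mulVec, ← mulVec_transpose, hs, hM.mulVec_eigenvectorBasis, smul_dotProduct,
      smul_eq_mul]
  rw [this]
  ring

/-- Weights in `[0, 1]` of total at least `N - r` give the least sum when placed on the `N - r`
smallest values. Termwise, `w s` minus the indicator of the tail has the sign of `l s - l r` or
vanishes with it, so `l` may be replaced by its threshold value. -/
theorem sum_tail_le_sum_mul {N r : ℕ} {l w : Fin N → ℝ} (hl : Antitone l) (hl0 : ∀ s, 0 ≤ l s)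
    (hw0 : ∀ s, 0 ≤ w s) (hw1 : ∀ s, w s ≤ 1) (hw : (N : ℝ) - r ≤ ∑ s, w s) :
    ∑ s : Fin N with r ≤ s.val, l s ≤ ∑ s, w s * l s := by
  rw [Finset.sum_filter]
  by_cases hr : r < N
  · set c := l ⟨r, hr⟩ with hc
    have h1 : ∑ s : Fin N, (w s - if r ≤ s.val then 1 else 0) * c ≤
        ∑ s : Fin N, (w s - if r ≤ s.val then 1 else 0) * l s := by
      refine Finset.sum_le_sum fun s _ => ?_
      split_ifs with h
      · have : l s ≤ c := hl (Fin.mk_le_of_le_val h)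
        nlinarith [hw1 s]
      · have : c ≤ l s := hl (Fin.le_iff_val_le_val.2 (not_le.1 h).le)
        nlinarith [hw0 s]
    have h2 : ∑ s : Fin N, (if r ≤ s.val then (1 : ℝ) else 0) = N - r := by
      rw [Finset.sum_boole]
      have : (Finset.univ.filter fun s : Fin N => r ≤ s.val) = Finset.Ici ⟨r, hr⟩ := by
        ext s; simp [Fin.le_iff_val_le_val]
      rw [this, Fin.card_Ici, Nat.cast_sub hr.le]
    rw [← Finset.sum_mul, Finset.sum_sub_distrib, h2] at h1
    have h3 : 0 ≤ (∑ s, w s - (N - r)) * c := mul_nonneg (by linarith) (hl0 _)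
    have h4 : ∑ s : Fin N, (w s - if r ≤ s.val then 1 else 0) * l s =
        ∑ s, w s * l s - ∑ s : Fin N, if r ≤ s.val then l s else 0 := by
      rw [← Finset.sum_sub_distrib]
      refine Finset.sum_congr rfl fun s _ => ?_
      split_ifs <;> ring
    linarith
  · refine (Finset.sum_nonpos fun s _ => ?_).trans
      (Finset.sum_nonneg fun s _ => mul_nonneg (hw0 s) (hl0 s))
    rw [if_neg (by have := s.isLt; omega)]

/-- If `Z` agrees with `L` on the orthogonal complement of an `r`-dimensional space, its trace is at
least the sum of all but the `r` largest eigenvalues of `L`. -/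
theorem sum_tail_eigenvalues_le_trace {L Z : Matrix ι ι ℝ} (hL : L.PosSemidef)
    (hZ : Z.PosSemidef) {V : Submodule ℝ (EuclideanSpace ℝ ι)} {r : ℕ}
    (hV : Module.finrank ℝ V ≤ r) (h : ∀ x ∈ Vᗮ, Z *ᵥ x.ofLp = L *ᵥ x.ofLp) :
    ∑ s : Fin (Fintype.card ι) with r ≤ s.val, hL.1.eigenvalues₀ s ≤ Z.trace := by
  -- The trace of `Z` dominates its quadratic form summed over an orthonormal basis of `Vᗮ`, where
  -- `Z` may be replaced by `L`. In the eigenbasis of `L` this sum weights each eigenvalue by the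
  -- squared length of the projection of its eigenvector to `Vᗮ`; these weights are at most `1` and
  -- add up to the dimension of `Vᗮ`.
  let b := stdOrthonormalBasis ℝ Vᗮ
  let v : Fin (Module.finrank ℝ Vᗮ) → EuclideanSpace ℝ ι := fun a => (b a : EuclideanSpace ℝ ι)
  have hv : Orthonormal ℝ v := b.orthonormal.comp_linearIsometry Vᗮ.subtypeₗᵢ
  have bessel : ∀ x : EuclideanSpace ℝ ι, ‖x‖ = 1 → ∑ a, inner ℝ x (v a) ^ 2 ≤ 1 := by
    intro x hx
    have := hv.sum_inner_products_le x (s := Finset.univ)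
    rw [hx] at this
    simpa [real_inner_comm] using this
  have h1 : ∑ a, (v a).ofLp ⬝ᵥ (Z *ᵥ (v a).ofLp) ≤ Z.trace := by
    rw [hZ.1.trace_eq_sum_eigenvalues]
    simp only [dotProduct_mulVec_eq_sum hZ.1]
    rw [Finset.sum_comm]
    refine Finset.sum_le_sum fun i _ => ?_
    rw [← Finset.mul_sum]
    exact mul_le_of_le_one_right (hZ.eigenvalues_nonneg i)
      (bessel _ (hZ.1.eigenvectorBasis.orthonormal.1 i))
  refine le_trans ?_ h1
  have h2 : ∑ a, (v a).ofLp ⬝ᵥ (Z *ᵥ (v a).ofLp) =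
      ∑ i, (∑ a, inner ℝ (hL.1.eigenvectorBasis i) (v a) ^ 2) * hL.1.eigenvalues i := by
    simp only [fun a => h (v a) (b a).2, dotProduct_mulVec_eq_sum hL.1]
    rw [Finset.sum_comm]
    refine Finset.sum_congr rfl fun i _ => ?_
    rw [← Finset.mul_sum, mul_comm]
  rw [h2]
  let e : Fin (Fintype.card ι) ≃ ι := Fintype.equivOfCardEq (Fintype.card_fin _)
  rw [← e.sum_comp]
  have he : ∀ s, hL.1.eigenvalues (e s) = hL.1.eigenvalues₀ s := fun s => by
    simp [IsHermitian.eigenvalues, e]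
  simp only [he]
  refine sum_tail_le_sum_mul hL.1.eigenvalues₀_antitone
    (fun s => by rw [← he]; exact hL.eigenvalues_nonneg _)
    (fun s => Finset.sum_nonneg fun a _ => sq_nonneg _)
    (fun s => bessel _ (hL.1.eigenvectorBasis.orthonormal.1 _)) ?_
  rw [e.sum_comp (fun i => ∑ a, inner ℝ (hL.1.eigenvectorBasis i) (v a) ^ 2), Finset.sum_comm]
  have h3 : ∀ a, ∑ i, inner ℝ (hL.1.eigenvectorBasis i) (v a) ^ 2 = 1 := by
    intro a
    have := hL.1.eigenvectorBasis.sum_sq_norm_inner_right (v a)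
    rw [hv.1 a] at this
    simpa using this
  simp only [h3]
  have h4 := V.finrank_add_finrank_orthogonal
  rw [finrank_euclideanSpace] at h4
  simp only [Finset.sum_const, Finset.card_univ, Fintype.card_fin, nsmul_eq_mul, mul_one]
  have h5 : (Fintype.card ι : ℝ) = Module.finrank ℝ V + Module.finrank ℝ Vᗮ := by
    rw [← h4]; push_cast; rfl
  have h6 : (Module.finrank ℝ V : ℝ) ≤ r := by exact_mod_cast hV
  linarith

/-- `V` is spanned by the pivot rows: a vector orthogonal to such a row does not see the rank-one
correction made from it. -/
theorem exists_submodule_resid_eq (L : Matrix ι ι ℝ) (W : List ι) :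
    ∃ V : Submodule ℝ (EuclideanSpace ℝ ι), Module.finrank ℝ V ≤ W.length ∧
      ∀ x ∈ Vᗮ, resid L W *ᵥ x.ofLp = L *ᵥ x.ofLp := by
  induction W with
  | nil => exact ⟨⊥, by simp, fun x _ => rfl⟩
  | cons i W ih =>
    obtain ⟨V, hV, h⟩ := ih
    refine ⟨V ⊔ Submodule.span ℝ {WithLp.toLp 2 (resid L W i)}, ?_, fun x hx => ?_⟩
    · refine (Submodule.finrank_add_le_finrank_add_finrank _ _).trans ?_
      have h1 := finrank_span_le_card (R := ℝ)
        ({WithLp.toLp 2 (resid L W i)} : Set (EuclideanSpace ℝ ι))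
      rw [Set.toFinset_singleton, Finset.card_singleton] at h1
      simp only [List.length_cons]
      omega
    · rw [← Submodule.inf_orthogonal] at hx
      have h1 := h x hx.1
      have h2 : resid L W i ⬝ᵥ x.ofLp = 0 := by
        have := (Submodule.mem_orthogonal _ _).1 hx.2 _ (Submodule.mem_span_singleton_self _)
        rw [EuclideanSpace.inner_eq_star_dotProduct, star_trivial, dotProduct_comm] at this
        exact this
      rw [resid, pivot, sub_mulVec, h1, smul_mulVec, vecMulVec_mulVec, h2]
      simp

theorem matrix_rank_add_le (M N : Matrix ι ι ℝ) : (M + N).rank ≤ M.rank + N.rank := by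
  rw [rank, rank, rank, mulVecLin_add]
  exact (Submodule.finrank_mono (LinearMap.range_add_le _ _)).trans
    (Submodule.finrank_add_le_finrank_add_finrank _ _)

theorem rank_sub_resid_le (L : Matrix ι ι ℝ) (W : List ι) :
    (L - resid L W).rank ≤ W.length := by
  induction W with
  | nil => simp [resid]
  | cons i W ih =>
    have : L - resid L (i :: W) =
        (L - resid L W) + vecMulVec ((resid L W i i)⁻¹ • resid L W i) (resid L W i) := by
      rw [resid, pivot, smul_vecMulVec]; abel
    rw [this]
    refine (matrix_rank_add_le _ _).trans (Nat.add_le_add ih (rank_vecMulVec_le _ _))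

/-- Otherwise the residual matrix has trace zero, hence vanishes, and `L` is a sum of `W.length`
matrices of rank at most one. -/
theorem exists_resid_pos {L : Matrix ι ι ℝ} (hL : L.PosSemidef) {W : List ι}
    (h : W.length < L.rank) : ∃ j, 0 < resid L W j j := by
  by_contra! hc
  have hZ := resid_posSemidef hL W
  have h0 : resid L W = 0 := hZ.trace_eq_zero_iff.1
    (le_antisymm (Finset.sum_nonpos fun j _ => hc j) hZ.trace_nonneg)
  have := rank_sub_resid_le L W
  rw [h0, sub_zero] at this
  omega

theorem minor_eq_zero_of_rank_lt {L : Matrix ι ι ℝ} {T : Finset ι} (h : L.rank < T.card) :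
    minor L T = 0 := by
  by_contra hc
  have h1 := rank_of_isUnit _ ((isUnit_iff_isUnit_det _).2 (isUnit_iff_ne_zero.2 hc))
  have h2 := rank_submatrix_le L (fun i : T => (i : ι)) (fun i : T => (i : ι))
  rw [h1, Fintype.card_coe] at h2
  omega

theorem diag_le_eigenvalues₀ {L : Matrix ι ι ℝ} (hL : L.IsHermitian)
    (h : 0 < Fintype.card ι) (i : ι) : L i i ≤ hL.eigenvalues₀ ⟨0, h⟩ := by
  have h1 := dotProduct_mulVec_eq_sum hL (EuclideanSpace.single i 1)
  have h2 := hL.eigenvectorBasis.sum_sq_norm_inner_right (EuclideanSpace.single i (1 : ℝ))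
  simp only [PiLp.ofLp_single, mulVec_single_one, single_one_dotProduct, col_apply] at h1
  simp only [PiLp.norm_single, norm_one, one_pow, Real.norm_eq_abs, sq_abs] at h2
  have h3 : hL.eigenvalues₀ ⟨0, h⟩ = hL.eigenvalues₀ ⟨0, h⟩ *
      ∑ j, inner ℝ (hL.eigenvectorBasis j) (EuclideanSpace.single i (1 : ℝ)) ^ 2 := by
    rw [h2, mul_one]
  rw [h1, h3, Finset.mul_sum]
  refine Finset.sum_le_sum fun j _ => mul_le_mul_of_nonneg_right ?_ (sq_nonneg _)
  exact hL.eigenvalues₀_antitone (Fin.mk_le_of_le_val (Nat.zero_le _))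

end KyFan

/-! ### Gram matrix, its ordered eigenvalues and their tail sums. -/

section Lam

variable {m n : ℕ} (A : Matrix (Fin m) (Fin n) ℝ)

theorem posSemidef_gram : (A * Aᵀ).PosSemidef := by
  simpa [conjTranspose_eq_transpose_of_trivial] using posSemidef_self_mul_conjTranspose A

theorem detRows_eq_minor (S : Finset (Fin m)) : detRows A S = minor (A * Aᵀ) S := by
  rw [detRows, minor, transpose_submatrix, submatrix_mul _ _ _ id _ Function.bijective_id]

theorem detRows_nonneg (S : Finset (Fin m)) : 0 ≤ detRows A S := by
  rw [detRows_eq_minor]; exact minor_nonneg (posSemidef_gram A) S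

theorem lam_eq {t : ℕ} (h1 : 1 ≤ t) (h2 : t ≤ m) :
    lam A t = (isHermitian_gram A).eigenvalues₀ ⟨t - 1, by rw [Fintype.card_fin]; omega⟩ :=
  dif_pos ⟨h1, h2⟩

theorem eigenvalues₀_gram_nonneg (s) : 0 ≤ (isHermitian_gram A).eigenvalues₀ s := by
  have := (posSemidef_gram A).eigenvalues_nonneg
    (Fintype.equivOfCardEq (Fintype.card_fin (Fintype.card (Fin m))) s)
  simpa [IsHermitian.eigenvalues] using this

theorem lam_nonneg (t : ℕ) : 0 ≤ lam A t := by
  rw [lam]; split_ifs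
  · exact eigenvalues₀_gram_nonneg A _
  · exact le_rfl

theorem lam_anti {s t : ℕ} (hs : 1 ≤ s) (hst : s ≤ t) (ht : t ≤ m) : lam A t ≤ lam A s := by
  rw [lam_eq A hs (hst.trans ht), lam_eq A (hs.trans hst) ht]
  exact (isHermitian_gram A).eigenvalues₀_antitone (Fin.mk_le_mk.2 (by omega))

theorem sum_lam_eq {k : ℕ} (hk : 1 ≤ k) :
    ∑ t ∈ Finset.Icc k m, lam A t = ∑ s : Fin (Fintype.card (Fin m)) with k - 1 ≤ s.val,
      (isHermitian_gram A).eigenvalues₀ s := by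
  symm
  refine Finset.sum_bij (fun s _ => s.val + 1) ?_ ?_ ?_ ?_
  · intro s hs
    have := s.isLt.trans_eq (Fintype.card_fin m)
    simp at hs ⊢
    omega
  · intro a _ b _ h
    exact Fin.ext (by omega)
  · intro t ht
    rw [Finset.mem_Icc] at ht
    exact ⟨⟨t - 1, by rw [Fintype.card_fin]; omega⟩, by simp; omega, by simp; omega⟩
  · intro s _
    have := s.isLt.trans_eq (Fintype.card_fin m)
    rw [lam_eq A (by omega) (by omega)]
    rfl

/-- The rank counts the non-zero eigenvalues; if the tail vanished, they would all lie in the first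
`k - 1` positions. -/
theorem sum_lam_pos {k : ℕ} (hk : 1 ≤ k) (hr : k ≤ (A * Aᵀ).rank) :
    0 < ∑ t ∈ Finset.Icc k m, lam A t := by
  rw [sum_lam_eq A hk]
  by_contra! hc
  have h0 : ∀ s : Fin (Fintype.card (Fin m)), k - 1 ≤ s.val →
      (isHermitian_gram A).eigenvalues₀ s = 0 := by
    intro s hs
    have := (Finset.sum_eq_zero_iff_of_nonneg fun s _ => eigenvalues₀_gram_nonneg A s).1
      (le_antisymm hc (Finset.sum_nonneg fun s _ => eigenvalues₀_gram_nonneg A s)) s (by simpa using by omega)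
    exact this
  rw [(isHermitian_gram A).rank_eq_card_non_zero_eigs] at hr
  let f : {i // (isHermitian_gram A).eigenvalues i ≠ 0} → Fin (k - 1) := fun i =>
    ⟨((Fintype.equivOfCardEq (Fintype.card_fin (Fintype.card (Fin m)))).symm i.1).val, by
      by_contra h
      exact i.2 (h0 _ (not_lt.1 h))⟩
  have hf : Function.Injective f := by
    intro a b h
    have := Fin.ext (Fin.mk.inj_iff.1 h)
    exact Subtype.ext ((Equiv.injective _) this)
  have := Fintype.card_le_of_injective f hf
  rw [Fintype.card_fin] at this
  omega

end Lam

/-! ### Approximation guarantees of the greedy set. -/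

section Greedy

variable {m n : ℕ} {A : Matrix (Fin m) (Fin n) ℝ}

theorem IsGreedy.card_eq {t : ℕ} {S : Finset (Fin m)} (h : IsGreedy A t S) : S.card = t := by
  induction h with
  | start => rfl
  | step _ hi _ ih => rw [Finset.card_insert_of_notMem hi, ih]

/-- Passage from sets to pivot lists: the determinant after adding `j` is the current determinant
times the residual entry at `j`, so for a positive current determinant both maximizations coincide.
-/
theorem IsGreedy.exists_list {t : ℕ} {S : Finset (Fin m)} (h : IsGreedy A t S)
    (hS : 0 < detRows A S) :
    ∃ W : List (Fin m), W.Nodup ∧ W.toFinset = S ∧ W.length = t ∧ IsGreedyList (A * Aᵀ) W := by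
  have hL := posSemidef_gram A
  induction h with
  | start => exact ⟨[], by simp, rfl, rfl, trivial⟩
  | @step t S i _ hi hmax ih =>
    -- The determinant of the smaller set is a factor of that of the larger one.
    have hpos : 0 < detRows A S := by
      refine lt_of_le_of_ne (detRows_nonneg A S) fun h0 => ?_
      rw [detRows_eq_minor, Finset.insert_eq, Finset.union_comm] at hS
      rw [detRows_eq_minor] at h0
      have h1 := minor_union hL (Finset.nodup_toList S) (U := {i}) (by simpa using fun h => hi h)
      rw [← minor_toFinset hL (Finset.nodup_toList S), Finset.toList_toFinset, ← h0,
        zero_mul] at h1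
      exact hS.ne' h1
    obtain ⟨W, hW, rfl, hlen, hg⟩ := ih hpos
    rw [detRows_eq_minor, minor_toFinset hL hW] at hpos
    have hdet : ∀ j, j ∉ W → detRows A (insert j W.toFinset) =
        pivotProd (A * Aᵀ) W * resid (A * Aᵀ) W j j := fun j hj => by
      rw [detRows_eq_minor, minor_insert_toFinset hL hW hj]
    rw [List.mem_toFinset] at hi
    rw [hdet i hi] at hS
    refine ⟨i :: W, List.nodup_cons.2 ⟨hi, hW⟩, by simp, by simp [hlen],
      fun j => ?_, pos_of_mul_pos_right hS hpos.le, hg⟩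
    by_cases hj : j ∈ W
    · rw [resid_apply_of_mem hL hj]
      exact (resid_posSemidef hL W).diag_nonneg
    · have := hmax j (by simpa using hj)
      rw [hdet i hi, hdet j hj] at this
      exact le_of_mul_le_mul_left this hpos

theorem IsGreedy.detRows_pos {t : ℕ} {S : Finset (Fin m)} (h : IsGreedy A t S)
    (ht : t ≤ A.rank) : 0 < detRows A S := by
  have hL := posSemidef_gram A
  induction h with
  | start => simp [detRows_eq_minor]
  | @step t S i h hi hmax ih =>
    have hpos := ih (by omega)
    obtain ⟨W, hW, rfl, hlen, hg⟩ := h.exists_list hpos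
    obtain ⟨j, hj⟩ := exists_resid_pos hL (W := W) (by rw [rank_self_mul_transpose]; omega)
    have hjW : j ∉ W := fun h => by rw [resid_apply_of_mem hL h] at hj; exact lt_irrefl _ hj
    refine lt_of_lt_of_le ?_ (hmax j (by simpa using hjW))
    rw [detRows_eq_minor, minor_toFinset hL hW] at hpos
    rw [detRows_eq_minor, minor_insert_toFinset hL hW hjW]
    exact mul_pos hpos hj

theorem detRows_eq_zero {T : Finset (Fin m)} (h : A.rank < T.card) : detRows A T = 0 := by
  rw [detRows_eq_minor]
  exact minor_eq_zero_of_rank_lt (by rwa [rank_self_mul_transpose])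

/-- The greedy algorithm is a `k ^ k`-approximation. -/
theorem IsGreedy.detRows_le {k : ℕ} {S : Finset (Fin m)} (h : IsGreedy A k S)
    {T : Finset (Fin m)} (hT : T.card = k) : detRows A T ≤ (k : ℝ) ^ k * detRows A S := by
  by_cases hr : k ≤ A.rank
  · obtain ⟨W, hW, rfl, rfl, hg⟩ := h.exists_list (h.detRows_pos hr)
    have hL := posSemidef_gram A
    rw [detRows_eq_minor, detRows_eq_minor, minor_toFinset hL hW]
    exact hg.minor_le hL hT
  · rw [detRows_eq_zero (hT.symm ▸ not_le.1 hr)]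
    exact mul_nonneg (by positivity) (detRows_nonneg A S)

/-- The average of the eigenvalues `λ_k, …, λ_m`. -/
noncomputable def tailAvg (A : Matrix (Fin m) (Fin n) ℝ) (k : ℕ) : ℝ :=
  1 / ((m : ℝ) - (k : ℝ) + 1) * ∑ t ∈ Finset.Icc k m, lam A t

theorem tailAvg_nonneg {k : ℕ} (hkm : k ≤ m) : 0 ≤ tailAvg A k := by
  have : (k : ℝ) ≤ m := by exact_mod_cast hkm
  exact mul_nonneg (one_div_nonneg.2 (by linarith)) (Finset.sum_nonneg fun t _ => lam_nonneg A t)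

/-- It suffices to bound the last pivot, the smallest. The trace of the residual matrix before it is
at least the tail sum, and at most `m - k + 1` times this pivot. -/
theorem IsGreedy.pow_tailAvg_le {k : ℕ} (hk : 1 ≤ k) (hkm : k ≤ m) (hr : k ≤ A.rank)
    {S : Finset (Fin m)} (h : IsGreedy A k S) : tailAvg A k ^ k ≤ detRows A S := by
  have hL := posSemidef_gram A
  obtain ⟨W, hW, rfl, rfl, hg⟩ := h.exists_list (h.detRows_pos hr)
  obtain ⟨i, W, rfl⟩ := List.exists_cons_of_length_pos hk
  rw [detRows_eq_minor, minor_toFinset hL hW]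
  refine IsGreedyList.pow_le_pivotProd (tailAvg_nonneg hkm) fun i' W' hs => ?_
  refine le_trans ?_ (hg.pivot_antitone hL hs)
  obtain ⟨V, hV, hVr⟩ := exists_submodule_resid_eq (A * Aᵀ) W
  have htr := sum_tail_eigenvalues_le_trace hL (resid_posSemidef hL W) hV hVr
  have hsum := sum_lam_eq A hk
  simp only [List.length_cons, Nat.add_sub_cancel] at hsum
  rw [← hsum] at htr
  have hW' := (List.nodup_cons.1 hW).2
  have hle : (resid (A * Aᵀ) W).trace ≤
      ((m : ℝ) - W.length) * resid (A * Aᵀ) W i i := by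
    have h1 : (resid (A * Aᵀ) W).trace ≤
        ∑ j : Fin m, if j ∈ W.toFinset then 0 else resid (A * Aᵀ) W i i := by
      refine Finset.sum_le_sum fun j _ => ?_
      split_ifs with hj
      · rw [diag_apply, resid_apply_of_mem hL (List.mem_toFinset.1 hj)]
      · exact hg.1 j
    refine h1.trans (le_of_eq ?_)
    rw [Finset.sum_ite, Finset.sum_const_zero, zero_add, Finset.sum_const, nsmul_eq_mul,
      Finset.filter_not, Finset.filter_mem_eq_inter, Finset.univ_inter,
      ← Finset.compl_eq_univ_sdiff, Finset.card_compl, Fintype.card_fin,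
      List.toFinset_card_of_nodup hW', Nat.cast_sub (by simp at hkm; omega)]
  rw [tailAvg]
  have hkm' : ((i :: W).length : ℝ) ≤ m := by exact_mod_cast hkm
  simp only [List.length_cons, Nat.cast_add, Nat.cast_one] at hkm' ⊢
  rw [one_div, inv_mul_le_iff₀ (by linarith)]
  calc _ ≤ _ := htr.trans hle
    _ = _ := by ring

theorem detRows_le_pow_lam {k : ℕ} (hk : 1 ≤ k) {T : Finset (Fin m)} (hT : T.card = k) :
    detRows A T ≤ lam A 1 ^ k := by
  have hm : 1 ≤ m := by
    have := T.card_le_univ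
    rw [Fintype.card_fin] at this
    omega
  rw [detRows_eq_minor, ← hT]
  refine minor_le_pow (posSemidef_gram A) (fun i => ?_) T
  rw [lam_eq A le_rfl hm]
  exact diag_le_eigenvalues₀ _ _ i

theorem tailAvg_pos {k : ℕ} (hk : 1 ≤ k) (hkm : k ≤ m) (hr : k ≤ A.rank) : 0 < tailAvg A k := by
  have : (k : ℝ) ≤ m := by exact_mod_cast hkm
  exact mul_pos (one_div_pos.2 (by linarith))
    (sum_lam_pos A hk (by rwa [rank_self_mul_transpose]))

theorem kappa_eq (A : Matrix (Fin m) (Fin n) ℝ) (k : ℕ) : kappa A k = lam A 1 / tailAvg A k := rfl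

theorem le_tailAvg {k : ℕ} (hk : 1 ≤ k) (hkm : k ≤ m) : lam A m ≤ tailAvg A k := by
  have hkm' : (k : ℝ) ≤ m := by exact_mod_cast hkm
  rw [tailAvg, one_div, le_inv_mul_iff₀ (by linarith)]
  have : ∑ t ∈ Finset.Icc k m, lam A m ≤ ∑ t ∈ Finset.Icc k m, lam A t :=
    Finset.sum_le_sum fun t ht => by
      rw [Finset.mem_Icc] at ht
      exact lam_anti A (hk.trans ht.1) ht.2 le_rfl
  refine le_trans (le_of_eq ?_) this
  rw [Finset.sum_const, Nat.card_Icc, nsmul_eq_mul, Nat.cast_sub (by omega)]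
  push_cast
  ring

theorem kappa_le {k : ℕ} (hk : 1 ≤ k) (hkm : k ≤ m) (h : 0 < lam A m) :
    kappa A k ≤ lam A 1 / lam A m := by
  rw [kappa_eq]
  exact div_le_div_of_nonneg_left (lam_nonneg A 1) h (le_tailAvg hk hkm)

/-- Approximation guarantee of every set at least as good as a greedy one. -/
theorem IsGreedy.detRows_le_min {k : ℕ} (hk : 1 ≤ k) (hkm : k ≤ m) {S₀ S : Finset (Fin m)}
    (h : IsGreedy A k S₀) (hS : detRows A S₀ ≤ detRows A S) {T : Finset (Fin m)}
    (hT : T.card = k) :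
    detRows A T ≤ (2 : ℝ) ^ ((k : ℝ) * Real.logb 2 (min (k : ℝ) (kappa A k))) * detRows A S := by
  refine le_trans ?_ (mul_le_mul_of_nonneg_left hS (Real.rpow_nonneg zero_le_two _))
  by_cases hr : k ≤ A.rank
  · have hpos := tailAvg_pos hk hkm hr
    -- Positivity of `λ₁`, hence of the minimum, is needed for `2 ^ logb 2 x = x`.
    have h1 : 0 < lam A 1 := by
      have h2 : detRows A S₀ ≤ lam A 1 ^ k := detRows_le_pow_lam hk h.card_eq
      refine lt_of_le_of_ne (lam_nonneg A 1) fun h0 => ?_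
      rw [← h0, zero_pow (by omega)] at h2
      exact absurd (h.detRows_pos hr) (not_lt.2 h2)
    have hκ : 0 < kappa A k := div_pos h1 hpos
    have hk' : (0 : ℝ) < k := by exact_mod_cast hk
    have hmin : 0 < min (k : ℝ) (kappa A k) := lt_min hk' hκ
    rw [mul_comm (k : ℝ), Real.rpow_mul zero_le_two, Real.rpow_logb (by norm_num) (by norm_num) hmin,
      Real.rpow_natCast]
    rcases min_choice (k : ℝ) (kappa A k) with hc | hc <;> rw [hc]
    · exact h.detRows_le hT
    · calc detRows A T ≤ lam A 1 ^ k := detRows_le_pow_lam hk hT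
        _ = kappa A k ^ k * tailAvg A k ^ k := by
          rw [← mul_pow, kappa_eq, div_mul_cancel₀ _ hpos.ne']
        _ ≤ _ := mul_le_mul_of_nonneg_left (h.pow_tailAvg_le hk hkm hr) (pow_nonneg hκ.le _)
  -- Below full rank the left side is zero, whatever value `kappa` takes.
  · rw [detRows_eq_zero (hT.symm ▸ not_le.1 hr)]
    exact mul_nonneg (Real.rpow_nonneg zero_le_two _) (detRows_nonneg A S₀)

end Greedy

/-! ### Number of local search steps and existence of results. -/

section LocalSearch

variable {m n : ℕ} {A : Matrix (Fin m) (Fin n) ℝ} {k : ℕ} {ε : ℝ}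

theorem card_swap {S : Finset (Fin m)} {i j : Fin m} (hi : i ∈ S) (hj : j ∉ S) :
    (swap S i j).card = S.card := by
  rw [swap, Finset.card_insert_of_notMem (fun h => hj (Finset.mem_of_mem_erase h)),
    Finset.card_erase_add_one hi]

theorem SwapStep.card_eq {S S' : Finset (Fin m)} (h : SwapStep A k ε S S') :
    S'.card = S.card := by
  obtain ⟨i, hi, j, hj, rfl, -⟩ := h
  exact card_swap hi hj

theorem SwapStep.lt {S S' : Finset (Fin m)} (h : SwapStep A k ε S S') :
    (1 + ε / (k : ℝ)) * detRows A S < detRows A S' := by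
  obtain ⟨i, hi, j, hj, rfl, -, h⟩ := h
  exact h

theorem IsRun.card_eq {N : ℕ} {R : ℕ → Finset (Fin m)} (h : IsRun A k ε N R) {t : ℕ}
    (ht : t ≤ N) : (R t).card = k := by
  induction t with
  | zero => exact h.1.card_eq
  | succ t ih => rw [(h.2 t ht).card_eq, ih (Nat.le_of_succ_le ht)]

theorem IsRun.pow_mul_le {N : ℕ} {R : ℕ → Finset (Fin m)} (h : IsRun A k ε N R) (hε : 0 < ε)
    {t : ℕ} (ht : t ≤ N) : (1 + ε / (k : ℝ)) ^ t * detRows A (R 0) ≤ detRows A (R t) := by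
  induction t with
  | zero => simp
  | succ t ih =>
    rw [pow_succ', mul_assoc]
    exact (mul_le_mul_of_nonneg_left (ih (Nat.le_of_succ_le ht)) (by positivity)).trans
      (h.2 t ht).lt.le

theorem IsRun.detRows_le {N : ℕ} {R : ℕ → Finset (Fin m)} (h : IsRun A k ε N R) (hε : 0 < ε) :
    detRows A (R 0) ≤ detRows A (R N) := by
  refine le_trans ?_ (h.pow_mul_le hε le_rfl)
  refine le_mul_of_one_le_left (detRows_nonneg A _) (one_le_pow₀ ?_)
  have : 0 ≤ ε / (k : ℝ) := by positivity
  linarith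

/-- This follows from `log (1 + x) ≥ x / (1 + x)`, and treats `ε ≤ k` and `ε > k` together. -/
theorem half_min_le_log {x : ℝ} (hx : 0 < x) : min x 1 / 2 ≤ Real.log (1 + x) := by
  have h1 := Real.one_sub_inv_le_log_of_pos (show 0 < 1 + x by linarith)
  refine le_trans ?_ h1
  have e : 1 - (1 + x)⁻¹ = x / (1 + x) := by field_simp; ring
  rw [e, div_le_div_iff₀ two_pos (by linarith)]
  rcases le_total x 1 with h | h
  · rw [min_eq_left h]; nlinarith
  · rw [min_eq_right h]; linarith

/-- Comparing the gain `(1 + ε / k) ^ N` with the greedy bound `k ^ k` gives `N * log (1 + ε / k) ≤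
k * log k`. -/
theorem IsRun.length_le {N : ℕ} {R : ℕ → Finset (Fin m)} (h : IsRun A k ε N R) (hε : 0 < ε)
    (hk : 1 ≤ k) : (N : ℝ) ≤ 2 * ((k : ℝ) ^ 2 * Real.log k / min ε (k : ℝ)) := by
  have hk' : (1 : ℝ) ≤ k := by exact_mod_cast hk
  have hk0 : (0 : ℝ) < k := by linarith
  have hlog := Real.log_nonneg hk'
  have hmin : 0 < min ε (k : ℝ) := lt_min hε hk0
  rcases Nat.eq_zero_or_pos N with rfl | hN
  · rw [Nat.cast_zero]; positivity
  -- If the initial determinant were zero, the greedy bound would make all of them zero, against the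
  -- strict gain of the first step.
  have hpos : 0 < detRows A (R 0) := by
    refine lt_of_le_of_ne (detRows_nonneg A _) fun h0 => ?_
    have h1 := (h.2 0 hN).lt
    have h2 := h.1.detRows_le (h.card_eq (t := 1) hN)
    rw [← h0] at h1 h2
    linarith
  have h1 := (h.pow_mul_le hε le_rfl).trans (h.1.detRows_le (h.card_eq le_rfl))
  have h2 := le_of_mul_le_mul_right h1 hpos
  have hx : 0 < ε / k := by positivity
  have h3 := Real.log_le_log (by positivity) h2
  rw [Real.log_pow, Real.log_pow] at h3
  have h4 := mul_le_mul_of_nonneg_left (half_min_le_log hx) (Nat.cast_nonneg (α := ℝ) N)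
  have h5 : min (ε / k) 1 = min ε k / k := by
    rw [← min_div_div_right hk0.le, div_self hk0.ne']
  rw [h5] at h4
  have h6 := h4.trans h3
  rw [← mul_div_assoc, le_div_iff₀ hmin]
  have h7 : (N : ℝ) * (min ε k / k / 2) * (2 * k) ≤ k * Real.log k * (2 * k) :=
    mul_le_mul_of_nonneg_right h6 (by positivity)
  calc (N : ℝ) * min ε k = (N : ℝ) * (min ε k / k / 2) * (2 * k) := by field_simp
    _ ≤ _ := h7
    _ = _ := by ring

theorem exists_isGreedy (A : Matrix (Fin m) (Fin n) ℝ) {t : ℕ} (ht : t ≤ m) :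
    ∃ S, IsGreedy A t S := by
  induction t with
  | zero => exact ⟨∅, .start⟩
  | succ t ih =>
    obtain ⟨S, hS⟩ := ih (Nat.le_of_succ_le ht)
    have hne : (Sᶜ).Nonempty := by
      rw [← Finset.card_pos, Finset.card_compl, hS.card_eq, Fintype.card_fin]
      omega
    obtain ⟨i, hi, hmax⟩ := Finset.exists_max_image Sᶜ (fun j => detRows A (insert j S)) hne
    rw [Finset.mem_compl] at hi
    exact ⟨_, .step hS hi fun j hj => hmax j (Finset.mem_compl.2 hj)⟩

theorem IsRun.snoc {N : ℕ} {R : ℕ → Finset (Fin m)} (h : IsRun A k ε N R) {S' : Finset (Fin m)}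
    (hS : SwapStep A k ε (R N) S') : IsRun A k ε (N + 1) (Function.update R (N + 1) S') := by
  refine ⟨by rw [Function.update_of_ne (by omega)]; exact h.1, fun t ht => ?_⟩
  rw [Function.update_of_ne (by omega)]
  rcases Nat.lt_succ_iff_lt_or_eq.1 ht with h' | rfl
  · rw [Function.update_of_ne (by omega)]; exact h.2 t h'
  · rw [Function.update_self]; exact hS

/-- If no run ever stopped, runs could be prolonged beyond the bound on their length. -/
theorem exists_isResult (A : Matrix (Fin m) (Fin n) ℝ) (hk : 1 ≤ k) (hkm : k ≤ m) (hε : 0 < ε) :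
    ∃ S, IsResult A k ε S := by
  by_contra! hc
  have hrun : ∀ N, ∃ R : ℕ → Finset (Fin m), IsRun A k ε N R := by
    intro N
    induction N with
    | zero =>
      obtain ⟨S, hS⟩ := exists_isGreedy A hkm
      exact ⟨fun _ => S, hS, fun t ht => absurd ht (Nat.not_lt_zero t)⟩
    | succ N ih =>
      obtain ⟨R, hR⟩ := ih
      have hns : ¬ Stops A k ε (R N) := fun hs => hc _ ⟨N, R, hR, rfl, hs⟩
      rw [Stops] at hns
      push Not at hns
      obtain ⟨S', hS'⟩ := hns
      exact ⟨_, hR.snoc hS'⟩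
  obtain ⟨N, hN⟩ := exists_nat_gt (2 * ((k : ℝ) ^ 2 * Real.log k / min ε (k : ℝ)))
  obtain ⟨R, hR⟩ := hrun N
  exact absurd (hR.length_le hε hk) (not_le.2 hN)

theorem IsResult.card_eq {S : Finset (Fin m)} (h : IsResult A k ε S) : S.card = k := by
  obtain ⟨N, R, hR, rfl, -⟩ := h
  exact hR.card_eq le_rfl

theorem IsResult.detRows_le {S : Finset (Fin m)} (h : IsResult A k ε S) (hk : 1 ≤ k) (hkm : k ≤ m)
    (hε : 0 < ε) {T : Finset (Fin m)} (hT : T.card = k) :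
    detRows A T ≤ (2 : ℝ) ^ ((k : ℝ) * Real.logb 2 (min (k : ℝ) (kappa A k))) * detRows A S := by
  obtain ⟨N, R, hR, rfl, -⟩ := h
  exact hR.1.detRows_le_min hk hkm (hR.detRows_le hε) hT

end LocalSearch

/-! ### A Hoare calculus with costs for the machine. -/

section Logic

@[simp] theorem Mem.writeNat_nat (s : Mem) (a i v b j : ℕ) :
    (s.writeNat a i v).nat b j = if b = a ∧ j = i then v else s.nat b j := rfl

@[simp] theorem Mem.writeNat_real (s : Mem) (a i v : ℕ) : (s.writeNat a i v).real = s.real := rfl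

@[simp] theorem Mem.writeReal_nat (s : Mem) (a i j : ℕ) (v : ℝ) :
    (s.writeReal a i j v).nat = s.nat := rfl

@[simp] theorem Mem.writeReal_real (s : Mem) (a i j : ℕ) (v : ℝ) (b i' j' : ℕ) :
    (s.writeReal a i j v).real b i' j' =
      if b = a ∧ i' = i ∧ j' = j then v else s.real b i' j' := rfl

/-- The program writes to the natural array `a`. -/
def Prog.writesNat (a : ℕ) : Prog → Bool
  | .skip => false
  | .setNat b _ _ => b == a
  | .setReal _ _ _ _ => false
  | .seq p q => p.writesNat a || q.writesNat a
  | .ite _ p q => p.writesNat a || q.writesNat a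
  | .loop _ p => p.writesNat a

/-- The program writes to the real array `a`. -/
def Prog.writesReal (a : ℕ) : Prog → Bool
  | .skip => false
  | .setNat _ _ _ => false
  | .setReal b _ _ _ => b == a
  | .seq p q => p.writesReal a || q.writesReal a
  | .ite _ p q => p.writesReal a || q.writesReal a
  | .loop _ p => p.writesReal a

/-- The memories agree on all arrays that `p` does not write to. -/
def Frame (p : Prog) (s s' : Mem) : Prop :=
  (∀ a, p.writesNat a = false → s'.nat a = s.nat a) ∧
    ∀ a, p.writesReal a = false → s'.real a = s.real a

theorem Frame.refl (p : Prog) (s : Mem) : Frame p s s := ⟨fun _ _ => rfl, fun _ _ => rfl⟩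

theorem Frame.trans {p : Prog} {s s' s'' : Mem} (h : Frame p s s') (h' : Frame p s' s'') :
    Frame p s s'' :=
  ⟨fun a ha => (h'.1 a ha).trans (h.1 a ha), fun a ha => (h'.2 a ha).trans (h.2 a ha)⟩

theorem Frame.mono {p q : Prog} (hn : ∀ a, q.writesNat a = false → p.writesNat a = false)
    (hr : ∀ a, q.writesReal a = false → p.writesReal a = false) {s s' : Mem} (h : Frame p s s') :
    Frame q s s' :=
  ⟨fun a ha => h.1 a (hn a ha), fun a ha => h.2 a (hr a ha)⟩

/-- The arrays written by a concrete program are found by evaluation, so preservation of all other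
data reduces to `rfl`. -/
theorem frame_of_exec {p : Prog} {s s' : Mem} {T : ℕ} (h : Exec p s T s') : Frame p s s' := by
  induction h with
  | skip s => exact Frame.refl _ s
  | setNat s a i x =>
    refine ⟨fun b hb => ?_, fun _ _ => rfl⟩
    have : b ≠ a := by rintro rfl; simp [Prog.writesNat] at hb
    funext j
    simp [this]
  | setReal s a i j x =>
    refine ⟨fun _ _ => rfl, fun b hb => ?_⟩
    have : b ≠ a := by rintro rfl; simp [Prog.writesReal] at hb
    funext i' j'
    simp [this]
  | seq _ _ ih1 ih2 =>
    refine (ih1.mono ?_ ?_).trans (ih2.mono ?_ ?_) <;> intro a ha <;>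
      simp [Prog.writesNat, Prog.writesReal] at ha ⊢ <;> simp [ha]
  | iteTrue _ _ ih =>
    refine ih.mono ?_ ?_ <;> intro a ha <;>
      simp [Prog.writesNat, Prog.writesReal] at ha ⊢ <;> simp [ha]
  | iteFalse _ _ ih =>
    refine ih.mono ?_ ?_ <;> intro a ha <;>
      simp [Prog.writesNat, Prog.writesReal] at ha ⊢ <;> simp [ha]
  | loopDone _ => exact Frame.refl _ _
  | loopNext _ _ _ ih1 ih2 =>
    refine (ih1.mono ?_ ?_).trans ih2 <;> intro a ha <;>
      simpa [Prog.writesNat, Prog.writesReal] using ha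

/-- Started in `s`, the program halts after at most `c` operations in a memory satisfying `Q`. -/
def Run (p : Prog) (s : Mem) (c : ℕ) (Q : Mem → Prop) : Prop :=
  ∃ (T : ℕ) (s' : Mem), Exec p s T s' ∧ T ≤ c ∧ Q s'

theorem Run.mono {p : Prog} {s : Mem} {c c' : ℕ} {Q Q' : Mem → Prop} (h : Run p s c Q)
    (hc : c ≤ c') (hQ : ∀ s', Frame p s s' → Q s' → Q' s') : Run p s c' Q' := by
  obtain ⟨T, s', h1, h2, h3⟩ := h
  exact ⟨T, s', h1, h2.trans hc, hQ s' (frame_of_exec h1) h3⟩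

theorem Run.cost_le {p : Prog} {s : Mem} {c c' : ℕ} {Q : Mem → Prop} (h : Run p s c Q)
    (hc : c ≤ c') : Run p s c' Q :=
  h.mono hc fun _ _ h => h

theorem Run.seq {p q : Prog} {s : Mem} {c c' : ℕ} {R Q : Mem → Prop} (hp : Run p s c R)
    (hq : ∀ s', Frame p s s' → R s' → Run q s' c' Q) : Run (.seq p q) s (c + c') Q := by
  obtain ⟨T, s', h1, h2, h3⟩ := hp
  obtain ⟨T', s'', h1', h2', h3'⟩ := hq s' (frame_of_exec h1) h3
  exact ⟨T + T', s'', .seq h1 h1', Nat.add_le_add h2 h2', h3'⟩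

theorem Run.setNat {s : Mem} {a : ℕ} {i x : NExpr} {Q : Mem → Prop}
    (h : Q (s.writeNat a (i.eval s) (x.eval s))) :
    Run (.setNat a i x) s (i.cost + x.cost + 1) Q :=
  ⟨_, _, .setNat s a i x, le_rfl, h⟩

theorem Run.setReal {s : Mem} {a : ℕ} {i j : NExpr} {x : RExpr} {Q : Mem → Prop}
    (h : Q (s.writeReal a (i.eval s) (j.eval s) (x.eval s))) :
    Run (.setReal a i j x) s (i.cost + j.cost + x.cost + 1) Q :=
  ⟨_, _, .setReal s a i j x, le_rfl, h⟩

theorem Run.ite {b : Test} {p q : Prog} {s : Mem} {c : ℕ} {Q : Mem → Prop}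
    (hp : b.Holds s → Run p s c Q) (hq : ¬ b.Holds s → Run q s c Q) :
    Run (.ite b p q) s (b.cost + c) Q := by
  by_cases hb : b.Holds s
  · obtain ⟨T, s', h1, h2, h3⟩ := hp hb
    exact ⟨_, s', .iteTrue hb h1, Nat.add_le_add_left h2 _, h3⟩
  · obtain ⟨T, s', h1, h2, h3⟩ := hq hb
    exact ⟨_, s', .iteFalse hb h1, Nat.add_le_add_left h2 _, h3⟩

theorem Run.skip {s : Mem} {Q : Mem → Prop} (h : Q s) : Run .skip s 1 Q :=
  ⟨_, _, .skip s, le_rfl, h⟩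

/-- A loop all of whose iterations but the last lead from `I i` to `I (i + 1)`, where `I i` can hold
for `i ≤ M` only. -/
theorem Run.loop {b : Test} {p : Prog} {c M : ℕ} {I : ℕ → Mem → Prop} {Q : Mem → Prop}
    (hM : ∀ i s, I i s → i ≤ M) (hb : ∀ i s, I i s → b.Holds s)
    (hstep : ∀ i s, I i s → Run p s c fun s' => I (i + 1) s' ∨ Q s')
    (hQ : ∀ s, Q s → ¬ b.Holds s) {s : Mem} (h : I 0 s) :
    Run (.loop b p) s ((M + 1) * (b.cost + c) + b.cost) Q := by
  have key : ∀ d i s, i + d = M → I i s →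
      Run (.loop b p) s ((d + 1) * (b.cost + c) + b.cost) Q := by
    intro d
    induction d with
    | zero =>
      intro i s hi hI
      obtain ⟨T, s', h1, h2, h3⟩ := hstep i s hI
      rcases h3 with h3 | h3
      · have := hM _ _ h3
        omega
      · exact ⟨_, s', .loopNext (hb i s hI) h1 (.loopDone (hQ s' h3)), by omega, h3⟩
    | succ d ih =>
      intro i s hi hI
      obtain ⟨T, s', h1, h2, h3⟩ := hstep i s hI
      rcases h3 with h3 | h3
      · obtain ⟨T', s'', h1', h2', h3'⟩ := ih (i + 1) s' (by omega) h3
        refine ⟨_, s'', .loopNext (hb i s hI) h1 h1', ?_, h3'⟩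
        calc _ ≤ b.cost + c + ((d + 1) * (b.cost + c) + b.cost) := by omega
          _ = _ := by ring
      · refine ⟨_, s', .loopNext (hb i s hI) h1 (.loopDone (hQ s' h3)), ?_, h3⟩
        calc _ ≤ 1 * (b.cost + c) + b.cost := by omega
          _ ≤ _ := by gcongr; omega
  exact key M 0 s (by omega) h

/-- `for c = 0, …, N - 1`, where `N` is the value of `b`; the counter is cell `0` of the natural
array `c`. -/
def forLoop (c : ℕ) (b : NExpr) (p : Prog) : Prog :=
  .seq (.setNat c (.const 0) (.const 0))
    (.loop (.natLt (.get c (.const 0)) b)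
      (.seq p (.setNat c (.const 0) (.add (.get c (.const 0)) (.const 1)))))

/-- The invariant must survive writes to the counter, since the increment follows the body. The
overhead per round is `b.cost + 3` for the test and `6` for the increment. -/
theorem Run.forLoop {c N d : ℕ} {b : NExpr} {p : Prog} {s₀ : Mem} (J : ℕ → Mem → Prop)
    (hc : p.writesNat c = false)
    (hN : ∀ s, Frame (forLoop c b p) s₀ s → b.eval s = N) (h0 : J 0 s₀)
    (hJ : ∀ i s v, J i s → J i (s.writeNat c 0 v))
    (hstep : ∀ i < N, ∀ s, Frame (MAPkDPP.forLoop c b p) s₀ s → s.nat c 0 = i → J i s →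
      Run p s d (J (i + 1))) :
    Run (MAPkDPP.forLoop c b p) s₀ (N * (d + b.cost + 9) + b.cost + 6) (J N) := by
  set P := MAPkDPP.forLoop c b p with hP
  have hwr : ∀ s v, Frame P s (s.writeNat c 0 v) := fun s v => by
    refine ⟨fun a ha => ?_, fun _ _ => rfl⟩
    have : a ≠ c := by
      rintro rfl
      simp [hP, MAPkDPP.forLoop, Prog.writesNat] at ha
    funext j
    simp [this]
  have hpP : ∀ s s', Frame p s s' → Frame P s s' := fun s s' h => by
    refine h.mono ?_ ?_ <;> intro a ha <;>
      simp [hP, MAPkDPP.forLoop, Prog.writesNat, Prog.writesReal] at ha ⊢ <;> simp [ha]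
  set body := Prog.seq p (.setNat c (.const 0) (.add (.get c (.const 0)) (.const 1))) with hbody
  have key : ∀ r i s, i + r = N → Frame P s₀ s → s.nat c 0 = i → J i s →
      Run (.loop (.natLt (.get c (.const 0)) b) body) s (r * (d + b.cost + 9) + b.cost + 3)
        (J N) := by
    intro r
    induction r with
    | zero =>
      intro i s hi hf hci hJi
      refine ⟨_, s, .loopDone ?_, ?_, by simpa [← hi] using hJi⟩
      · simp [Test.Holds, NExpr.eval, hN s hf, hci, ← hi]
      · simp [Test.cost, NExpr.cost]; omega
    | succ r ih =>
      intro i s hi hf hci hJi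
      obtain ⟨T, s', h1, h2, h3⟩ := hstep i (by omega) s hf hci hJi
      have hf' := frame_of_exec h1
      have hci' : s'.nat c 0 = i := by rw [hf'.1 c hc, hci]
      have hw := hwr s' (i + 1)
      obtain ⟨T', s'', h1', h2', h3'⟩ := ih (i + 1) (s'.writeNat c 0 (i + 1)) (by omega)
        ((hf.trans (hpP _ _ hf')).trans hw) (by simp) (hJ _ _ _ h3)
      have hset := Exec.setNat s' c (.const 0) (.add (.get c (.const 0)) (.const 1))
      simp only [NExpr.eval, hci'] at hset
      refine ⟨_, s'', .loopNext ?_ (.seq h1 hset) h1', ?_, h3'⟩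
      · simp only [Test.Holds, NExpr.eval, hN s hf, hci]; omega
      · simp only [Test.cost, NExpr.cost, Nat.succ_mul]
        omega
  obtain ⟨T, s', h1, h2, h3⟩ := key N 0 (s₀.writeNat c 0 0) (by omega) (hwr _ _) (by simp)
    (hJ _ _ _ h0)
  refine ⟨_, s', .seq (Exec.setNat s₀ c (.const 0) (.const 0)) h1, ?_, h3⟩
  simp only [NExpr.cost]
  omega

end Logic

/-! ### Elimination of all selected rows but one. -/

section Elimination

variable {ι : Type*} [Fintype ι] [DecidableEq ι]

/-- The list of `τ 0, …, τ (l - 1)` without `τ t`, in reverse order. -/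
def skipList (τ : ℕ → ι) (t : ℕ) : ℕ → List ι
  | 0 => []
  | l + 1 => if l = t then skipList τ t l else τ l :: skipList τ t l

theorem mem_skipList {τ : ℕ → ι} {t l : ℕ} {x : ι} :
    x ∈ skipList τ t l ↔ ∃ l' < l, l' ≠ t ∧ τ l' = x := by
  induction l with
  | zero => simp [skipList]
  | succ l ih =>
    rw [skipList]
    split_ifs with h
    · rw [ih]
      refine ⟨fun ⟨l', h1, h2⟩ => ⟨l', by omega, h2⟩, fun ⟨l', h1, h2⟩ => ⟨l', ?_, h2⟩⟩
      have := h2.1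
      omega
    · rw [List.mem_cons, ih]
      constructor
      · rintro (rfl | ⟨l', h1, h2⟩)
        · exact ⟨l, by omega, h, rfl⟩
        · exact ⟨l', by omega, h2⟩
      · rintro ⟨l', h1, h2, h3⟩
        rcases Nat.lt_succ_iff_lt_or_eq.1 h1 with h1 | rfl
        · exact Or.inr ⟨l', h1, h2, h3⟩
        · exact Or.inl h3.symm

theorem nodup_skipList {τ : ℕ → ι} {t l : ℕ} (h : Set.InjOn τ (Set.Iio l)) :
    (skipList τ t l).Nodup := by
  induction l with
  | zero => simp [skipList]
  | succ l ih =>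
    have ih' := ih (h.mono (Set.Iio_subset_Iio (Nat.le_succ l)))
    rw [skipList]
    split_ifs with hl
    · exact ih'
    · refine List.nodup_cons.2 ⟨fun hm => ?_, ih'⟩
      obtain ⟨l', h1, -, h3⟩ := mem_skipList.1 hm
      have := h (Set.mem_Iio.2 (by omega)) (Set.mem_Iio.2 (by omega)) h3
      omega

/-- The coefficient of the rank-one correction in the elimination of `τ l`. -/
noncomputable def elimCoef (L : Matrix ι ι ℝ) (τ : ℕ → ι) (t l : ℕ) : ℝ :=
  if l = t then 0 else (resid L (skipList τ t l) (τ l) (τ l))⁻¹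

/-- The coefficient `0` turns the skipped position into an ordinary step, so the program runs the
same recurrence at every position. -/
theorem resid_skipList_succ (L : Matrix ι ι ℝ) (τ : ℕ → ι) (t l : ℕ) (a b : ι) :
    resid L (skipList τ t (l + 1)) a b = resid L (skipList τ t l) a b -
      elimCoef L τ t l * resid L (skipList τ t l) (τ l) a * resid L (skipList τ t l) (τ l) b := by
  rw [elimCoef, skipList]
  split_ifs with h
  · ring
  · rw [resid, pivot_apply]; ring

end Elimination

/-! ### Program text of a scan. -/

section Programs

/-- The counter of the loops over the list of entries. -/
def entryIdx : NExpr := .get 4 (.const 0)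
-- Natural arrays: `3` selected rows; `4` to `7` counters for entries, earlier pivots, current
-- pivot, and greedy step or skipped position; `8` number of selected rows; `9`, `10` best row and
-- its position; `11` flag of the local search. Real arrays: `2` the matrix; `3` successive
-- residuals of the current pivot row; `4` pivot rows; `5` diagonals; `6` coefficients; `7` product
-- of pivots; `8` best value; `9` current determinant.
def pivotIdx : NExpr := .get 5 (.const 0)
def stepIdx : NExpr := .get 6 (.const 0)
def posIdx : NExpr := .get 7 (.const 0)
def lenExpr : NExpr := .get 8 (.const 0)
def sizeExpr : NExpr := .get 0 (.const 0)
def numExpr : NExpr := .get 0 (.const 1)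
def rowExpr : NExpr := .get 1 entryIdx
def colExpr : NExpr := .get 2 entryIdx
def valExpr : RExpr := .get 1 entryIdx (.const 0)

/-- Assign the value of `x` to cell `(i, row p)` of the real array `a`, for all entries `p`. -/
def assignRows (a : ℕ) (i : NExpr) (x : RExpr) : Prog :=
  forLoop 4 numExpr (.setReal a i rowExpr x)

/-- Put into cell `(0, j)` of the real array `a` the sum of the values of `x` over all entries `p`
in row `j`. -/
def accumRows (a : ℕ) (x : RExpr) : Prog :=
  .seq (assignRows a (.const 0) (.ofNat (.const 0)))
    (forLoop 4 numExpr
      (.setReal a (.const 0) rowExpr (.add (.get a (.const 0) rowExpr) x)))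

/-- Store the entries in the two-dimensional real array `2`. -/
def scatter : Prog :=
  forLoop 4 numExpr (.setReal 2 rowExpr colExpr valExpr)

/-- The row of the pivot `l` in the residual matrix, in row `l` of the real array `4`. -/
def pivotRow : Prog :=
  .seq (accumRows 3 (.mul valExpr (.get 2 (.get 3 stepIdx) colExpr)))
    (.seq
      (forLoop 5 stepIdx (assignRows 3 (.add pivotIdx (.const 1))
        (.sub (.get 3 pivotIdx rowExpr)
          (.mul (.mul (.get 6 pivotIdx (.const 0)) (.get 4 pivotIdx (.get 3 stepIdx)))
            (.get 4 pivotIdx rowExpr)))))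
      (assignRows 4 stepIdx (.get 3 stepIdx rowExpr)))

/-- The correction coefficient of the pivot `l` and the product of the pivots. -/
def pivotCoef : Prog :=
  .ite (.natEq stepIdx posIdx)
    (.setReal 6 stepIdx (.const 0) (.ofNat (.const 0)))
    (.seq
      (.setReal 6 stepIdx (.const 0)
        (.div (.ofNat (.const 1)) (.get 4 stepIdx (.get 3 stepIdx))))
      (.setReal 7 (.const 0) (.const 0)
        (.mul (.get 4 stepIdx (.get 3 stepIdx)) (.get 7 (.const 0) (.const 0)))))

/-- The diagonal of the residual matrix after the pivot `l`, in row `l + 1` of the real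
array `5`. -/
def pivotDiag : Prog :=
  assignRows 5 (.add stepIdx (.const 1))
    (.sub (.get 5 stepIdx rowExpr)
      (.mul (.mul (.get 6 stepIdx (.const 0)) (.get 4 stepIdx rowExpr))
        (.get 4 stepIdx rowExpr)))

def pivotStep : Prog := .seq pivotRow (.seq pivotCoef pivotDiag)

/-- The determinant obtained by adding the row of the current entry. -/
def scoreExpr : RExpr := .mul (.get 7 (.const 0) (.const 0)) (.get 5 lenExpr rowExpr)

def updateBest : Prog :=
  .ite (.realLt (.get 8 (.const 0) (.const 0)) scoreExpr)
    (.seq (.setReal 8 (.const 0) (.const 0) scoreExpr)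
      (.seq (.setNat 9 (.const 0) rowExpr) (.setNat 10 (.const 0) posIdx)))
    .skip

/-- Eliminate the selected rows except the one in position `t`, and compare the determinants
obtained by adding any row with the best value so far. -/
def scan : Prog :=
  .seq (accumRows 5 (.mul valExpr valExpr))
    (.seq (.setReal 7 (.const 0) (.const 0) (.ofNat (.const 1)))
      (.seq (forLoop 6 lenExpr pivotStep) (forLoop 4 numExpr updateBest)))

end Programs

/-! ### Loops over the list of entries. -/

section Entries

/-- An enumeration of the non-zero entries of `A`. -/
structure Entries {m n : ℕ} (A : Matrix (Fin m) (Fin n) ℝ) where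
  num : ℕ
  row : ℕ → Fin m
  col : ℕ → Fin n
  -- This identity says that every non-zero position is listed exactly once; indicator functions
  -- recover the positions.
  sum_eq : ∀ F : Fin m → Fin n → ℝ, (∀ i j, A i j = 0 → F i j = 0) →
    ∑ p ∈ Finset.range num, F (row p) (col p) = ∑ i, ∑ j, F i j

variable {m n : ℕ} {A : Matrix (Fin m) (Fin n) ℝ} (d : Entries A)

/-- The entries are stored in the memory. -/
structure Entries.Loaded (s : Mem) : Prop where
  num : s.nat 0 1 = d.num
  row : ∀ p < d.num, s.nat 1 p = d.row p
  col : ∀ p < d.num, s.nat 2 p = d.col p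
  val : ∀ p < d.num, s.real 1 p 0 = A (d.row p) (d.col p)

variable {d}

theorem Entries.Loaded.congr {s s' : Mem} (h : d.Loaded s) (h0 : s'.nat 0 = s.nat 0)
    (h1 : s'.nat 1 = s.nat 1) (h2 : s'.nat 2 = s.nat 2) (hr : s'.real 1 = s.real 1) :
    d.Loaded s' :=
  ⟨by rw [h0, h.num], by rw [h1]; exact h.row, by rw [h2]; exact h.col, by rw [hr]; exact h.val⟩

theorem Entries.exists_of_ne_zero (d : Entries A) {i : Fin m} {j : Fin n} (h : A i j ≠ 0) :
    ∃ p < d.num, d.row p = i ∧ d.col p = j := by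
  by_contra! hc
  have h1 := d.sum_eq (fun i' j' => if i' = i ∧ j' = j then 1 else 0) (fun i' j' h0 => by
    rw [if_neg]
    rintro ⟨rfl, rfl⟩
    exact h h0)
  rw [Finset.sum_eq_zero fun p hp => if_neg fun hh => hc p (Finset.mem_range.1 hp) hh.1 hh.2] at h1
  have h2 : ∑ i' : Fin m, ∑ j' : Fin n, (if i' = i ∧ j' = j then (1 : ℝ) else 0) = 1 := by
    rw [Finset.sum_eq_single i, Finset.sum_eq_single j] <;> simp +contextual
  linarith

theorem Entries.sum_row_eq (d : Entries A) (i j : Fin m) :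
    ∑ p ∈ Finset.range d.num,
      (if d.row p = j then A (d.row p) (d.col p) * A i (d.col p) else 0) = (A * Aᵀ) i j := by
  rw [d.sum_eq (fun i' j' => if i' = j then A i' j' * A i j' else 0)
    (fun i' j' h => by simp [h]), Finset.sum_eq_single j]
  · simp [mul_apply, mul_comm]
  · intro b _ hb
    simp [hb]
  · simp

/-- The memories agree except for the loop counter and row `i` of the real array `a`. -/
structure SameOff (a i : ℕ) (s s' : Mem) : Prop where
  nat : ∀ b ≠ 4, s'.nat b = s.nat b
  real : ∀ b ≠ a, s'.real b = s.real b
  off : ∀ i' j, i' ≠ i → s'.real a i' j = s.real a i' j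

/-- A row with several entries is assigned several times. This is harmless because `x` may not
depend on the row of the array being written; hence updates go from one array row to the next and
never act in place. -/
theorem run_assignRows {s : Mem} (hs : d.Loaded s) {a : ℕ} {i : NExpr} {x : RExpr} {i₀ : ℕ}
    (f : Fin m → ℝ) (hi : ∀ s', (∀ b ≠ 4, s'.nat b = s.nat b) → i.eval s' = i₀)
    (hx : ∀ p < d.num, ∀ s', s'.nat 4 0 = p → SameOff a i₀ s s' → x.eval s' = f (d.row p)) :
    Run (assignRows a i x) s (d.num * (i.cost + x.cost + 15) + 8) fun s' =>
      (∀ p < d.num, s'.real a i₀ (d.row p) = f (d.row p)) ∧ SameOff a i₀ s s' := by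
  have hfr : ∀ s', Frame (assignRows a i x) s s' →
      (∀ b ≠ 4, s'.nat b = s.nat b) ∧ ∀ b ≠ a, s'.real b = s.real b := fun s' hf =>
    ⟨fun b hb => hf.1 b (by simp [assignRows, forLoop, Prog.writesNat, hb.symm]),
      fun b hb => hf.2 b (by simp [assignRows, forLoop, Prog.writesReal, hb.symm])⟩
  refine (Run.forLoop (N := d.num) (d := i.cost + x.cost + 4)
    (fun P s' => (∀ p < P, s'.real a i₀ (d.row p) = f (d.row p)) ∧
      ∀ i' j, i' ≠ i₀ → s'.real a i' j = s.real a i' j) rfl ?_ ?_ (fun _ _ _ h => h) ?_).mono ?_ ?_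
  · intro s' hf
    have := (hfr s' hf).1 0 (by decide)
    simp [numExpr, NExpr.eval, this, hs.num]
  · exact ⟨fun p hp => absurd hp (Nat.not_lt_zero p), fun _ _ _ => rfl⟩
  · intro p hp s' hf hc hJ
    obtain ⟨h1, h2⟩ := hfr s' hf
    refine Run.mono (Run.setReal (Q := fun s' => (∀ q < p + 1, s'.real a i₀ (d.row q) =
      f (d.row q)) ∧ ∀ i' j, i' ≠ i₀ → s'.real a i' j = s.real a i' j) ?_) ?_ fun _ _ h => h
    · rw [hi s' h1, hx p hp s' hc ⟨h1, h2, hJ.2⟩]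
      have hrow : rowExpr.eval s' = d.row p := by
        simp [rowExpr, entryIdx, NExpr.eval, hc, h1 1 (by decide), hs.row p hp]
      rw [hrow]
      refine ⟨fun q hq => ?_, fun i' j hi' => ?_⟩
      · by_cases hqp : d.row q = d.row p
        · simp [hqp]
        · have : q ≠ p := fun h => hqp (by rw [h])
          simp [Fin.val_inj, hqp, hJ.1 q (by omega)]
      · simp [hi', hJ.2 i' j hi']
    · simp only [rowExpr, entryIdx, NExpr.cost]; omega
  · exact le_of_eq (by simp only [numExpr, NExpr.cost])
  · intro s' hf h
    exact ⟨h.1, (hfr s' hf).1, (hfr s' hf).2, h.2⟩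

/-- The initial clearing also runs over the entries and not over all rows, so the cost does not
involve `m`. -/
theorem run_accumRows {s : Mem} (hs : d.Loaded s) {a : ℕ} (ha : a ≠ 1) {x : RExpr} (F : ℕ → ℝ)
    (hx : ∀ p < d.num, ∀ s', s'.nat 4 0 = p → SameOff a 0 s s' → x.eval s' = F p) :
    Run (accumRows a x) s (d.num * (x.cost + 40) + 16) fun s' =>
      (∀ p < d.num, s'.real a 0 (d.row p) =
        ∑ q ∈ Finset.range d.num, if d.row q = d.row p then F q else 0) ∧ SameOff a 0 s s' := by
  refine Run.mono (Run.seq (c' := d.num * (x.cost + 22) + 8) (run_assignRows hs (i₀ := 0) (fun _ => 0) (fun _ _ => rfl)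
    (fun _ _ _ _ _ => by simp [RExpr.eval, NExpr.eval])) fun s₁ _ h₁ => ?_) ?_ fun _ _ h => h
  · have hs₁ : d.Loaded s₁ := hs.congr (h₁.2.nat 0 (by decide)) (h₁.2.nat 1 (by decide))
      (h₁.2.nat 2 (by decide)) (h₁.2.real 1 ha.symm)
    set P := forLoop 4 numExpr
      (.setReal a (.const 0) rowExpr (.add (.get a (.const 0) rowExpr) x)) with hP
    have hfr : ∀ s', Frame P s₁ s' →
        (∀ b ≠ 4, s'.nat b = s₁.nat b) ∧ ∀ b ≠ a, s'.real b = s₁.real b := fun s' hf =>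
      ⟨fun b hb => hf.1 b (by simp [hP, forLoop, Prog.writesNat, hb.symm]),
        fun b hb => hf.2 b (by simp [hP, forLoop, Prog.writesReal, hb.symm])⟩
    refine (Run.forLoop (N := d.num) (d := x.cost + 11)
      (fun P s' => (∀ p < d.num, s'.real a 0 (d.row p) =
        ∑ q ∈ Finset.range P, if d.row q = d.row p then F q else 0) ∧
        ∀ i' j, i' ≠ 0 → s'.real a i' j = s.real a i' j) rfl ?_ ?_ (fun _ _ _ h => h) ?_).mono ?_ ?_
    · intro s' hf
      have := (hfr s' hf).1 0 (by decide)
      simp [numExpr, NExpr.eval, this, hs₁.num]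
    · exact ⟨fun p hp => by simp [h₁.1 p hp], h₁.2.off⟩
    · intro p hp s' hf hc hJ
      obtain ⟨h1, h2⟩ := hfr s' hf
      have hsame : SameOff a 0 s s' := ⟨fun b hb => (h1 b hb).trans (h₁.2.nat b hb),
        fun b hb => (h2 b hb).trans (h₁.2.real b hb), hJ.2⟩
      refine Run.mono (Run.setReal (Q := fun s' => (∀ p' < d.num, s'.real a 0 (d.row p') =
        ∑ q ∈ Finset.range (p + 1), if d.row q = d.row p' then F q else 0) ∧
        ∀ i' j, i' ≠ 0 → s'.real a i' j = s.real a i' j) ?_) ?_ fun _ _ h => h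
      · have hrow : rowExpr.eval s' = d.row p := by
          simp [rowExpr, entryIdx, NExpr.eval, hc, h1 1 (by decide), hs₁.row p hp]
        simp only [RExpr.eval, NExpr.eval, hrow, hx p hp s' hc hsame]
        refine ⟨fun q hq => ?_, fun i' j hi' => ?_⟩
        · rw [Finset.sum_range_succ, ← hJ.1 q hq]
          by_cases hqp : d.row q = d.row p
          · simp [hqp]
          · simp [Fin.val_inj, hqp, Ne.symm hqp]
        · simp [hi', hJ.2 i' j hi']
      · simp [rowExpr, entryIdx, NExpr.cost, RExpr.cost]; omega
    · apply le_of_eq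
      simp only [numExpr, NExpr.cost]
    · intro s' hf h
      exact ⟨h.1, fun b hb => ((hfr s' hf).1 b hb).trans (h₁.2.nat b hb),
        fun b hb => ((hfr s' hf).2 b hb).trans (h₁.2.real b hb), h.2⟩
  · simp only [NExpr.cost, RExpr.cost]
    nlinarith

/-- The dense copy needs one write per entry only because the array is zero beforehand. -/
theorem run_scatter {s : Mem} (hs : d.Loaded s) (h0 : ∀ i j, s.real 2 i j = 0) :
    Run scatter s (d.num * 30 + 8) fun s' => ∀ (i : Fin m) (j : Fin n), s'.real 2 i j = A i j := by
  have hfr : ∀ s', Frame scatter s s' → d.Loaded s' := fun s' hf =>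
    hs.congr (hf.1 0 rfl) (hf.1 1 rfl) (hf.1 2 rfl) (hf.2 1 rfl)
  refine (Run.forLoop (N := d.num) (d := 12)
    (fun P s' => ∀ (i : Fin m) (j : Fin n), s'.real 2 i j =
      if ∃ p < P, d.row p = i ∧ d.col p = j then A i j else 0) rfl ?_ ?_ (fun _ _ _ h => h) ?_).mono
    ?_ ?_
  · intro s' hf
    simp [numExpr, NExpr.eval, (hfr s' hf).num]
  · simp [h0]
  · intro p hp s' hf hc hJ
    have hl := hfr s' hf
    refine Run.mono (Run.setReal (Q := fun s' => ∀ (i : Fin m) (j : Fin n), s'.real 2 i j =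
      if ∃ q < p + 1, d.row q = i ∧ d.col q = j then A i j else 0) ?_) ?_ fun _ _ h => h
    · simp only [rowExpr, colExpr, valExpr, entryIdx, RExpr.eval, NExpr.eval, hc, hl.row p hp,
        hl.col p hp, hl.val p hp]
      intro i j
      by_cases hij : d.row p = i ∧ d.col p = j
      · rw [if_pos ⟨p, Nat.lt_succ_self p, hij⟩, ← hij.1, ← hij.2]
        simp
      · have e : (∃ q < p + 1, d.row q = i ∧ d.col q = j) ↔ ∃ q < p, d.row q = i ∧ d.col q = j := by
          refine ⟨fun ⟨q, h1, h2⟩ => ⟨q, ?_, h2⟩, fun ⟨q, h1, h2⟩ => ⟨q, by omega, h2⟩⟩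
          rcases Nat.lt_succ_iff_lt_or_eq.1 h1 with h1 | rfl
          · exact h1
          · exact absurd h2 hij
        simp only [e, Mem.writeReal_real]
        rw [if_neg, hJ]
        rintro ⟨-, h1, h2⟩
        exact hij ⟨(Fin.val_inj.1 h1).symm, (Fin.val_inj.1 h2).symm⟩
    · decide
  · simp only [numExpr, NExpr.cost]
    omega
  · intro s' hf h i j
    rw [h]
    split_ifs with hc
    · rfl
    · by_contra hne
      exact hc (d.exists_of_ne_zero (Ne.symm hne))

end Entries

/-! ### Correctness and cost of a scan. -/

section Scan

variable {m n : ℕ} {A : Matrix (Fin m) (Fin n) ℝ} {d : Entries A}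

/-- The memory holds the matrix and the rows `τ 0, …, τ (q - 1)`, and the position `t` is to be
skipped. -/
structure Entries.Ready (d : Entries A) (τ : ℕ → Fin m) (q t : ℕ) (s : Mem) : Prop where
  loaded : d.Loaded s
  mat : ∀ (i : Fin m) (j : Fin n), s.real 2 i j = A i j
  sel : ∀ l < q, s.nat 3 l = τ l
  -- Residual values are maintained only at rows having an entry, so pivots must be looked up at
  -- such rows.
  row : ∀ l < q, ∃ p < d.num, d.row p = τ l
  pos : s.nat 7 0 = t
  len : s.nat 8 0 = q

theorem Entries.Ready.congr {τ : ℕ → Fin m} {q t : ℕ} {s s' : Mem} (h : d.Ready τ q t s)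
    (h0 : s'.nat 0 = s.nat 0) (h1 : s'.nat 1 = s.nat 1) (h2 : s'.nat 2 = s.nat 2)
    (h3 : s'.nat 3 = s.nat 3) (h7 : s'.nat 7 = s.nat 7) (h8 : s'.nat 8 = s.nat 8)
    (hr1 : s'.real 1 = s.real 1) (hr2 : s'.real 2 = s.real 2) : d.Ready τ q t s' where
  loaded := h.loaded.congr h0 h1 h2 hr1
  mat := by rw [hr2]; exact h.mat
  sel := by rw [h3]; exact h.sel
  row := h.row
  pos := by rw [h7]; exact h.pos
  len := by rw [h8]; exact h.len

theorem Entries.Ready.frame {τ : ℕ → Fin m} {q t : ℕ} {p : Prog} {s s' : Mem}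
    (h : d.Ready τ q t s) (hf : Frame p s s')
    (hw : ((p.writesNat 0 || p.writesNat 1 || p.writesNat 2 || p.writesNat 3 || p.writesNat 7 ||
      p.writesNat 8) || (p.writesReal 1 || p.writesReal 2)) = false) : d.Ready τ q t s' := by
  simp only [Bool.or_eq_false_iff] at hw
  obtain ⟨⟨⟨⟨⟨⟨h0, h1⟩, h2⟩, h3⟩, h7⟩, h8⟩, hr1, hr2⟩ := hw
  exact h.congr (hf.1 0 h0) (hf.1 1 h1) (hf.1 2 h2) (hf.1 3 h3) (hf.1 7 h7) (hf.1 8 h8)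
    (hf.2 1 hr1) (hf.2 2 hr2)

/-- The residual matrix after `l` steps of a scan. -/
noncomputable def scanResid (A : Matrix (Fin m) (Fin n) ℝ) (τ : ℕ → Fin m) (t l : ℕ) :
    Matrix (Fin m) (Fin m) ℝ :=
  resid (A * Aᵀ) (skipList τ t l)

theorem scanResid_succ (A : Matrix (Fin m) (Fin n) ℝ) (τ : ℕ → Fin m) (t l : ℕ) (a b : Fin m) :
    scanResid A τ t (l + 1) a b = scanResid A τ t l a b -
      elimCoef (A * Aᵀ) τ t l * scanResid A τ t l (τ l) a * scanResid A τ t l (τ l) b :=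
  resid_skipList_succ _ τ t l a b

/-- Row `u` of the real array `3` holds the row `τ l` of the residual matrix after `u` eliminations,
starting from the Gram matrix; only the rows and coefficients of earlier pivots are needed to
advance. -/
theorem run_pivotRow {τ : ℕ → Fin m} {q t l : ℕ} {s : Mem} (hs : d.Ready τ q t s) (hl : l < q)
    (hstep : s.nat 6 0 = l)
    (hZ : ∀ l' < l, ∀ p < d.num, s.real 4 l' (d.row p) = scanResid A τ t l' (τ l') (d.row p))
    (hg : ∀ l' < l, s.real 6 l' 0 = elimCoef (A * Aᵀ) τ t l') :
    Run pivotRow s (d.num * (75 + 44 * l) + 19 * l + 32) fun s' =>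
      ∀ l' < l + 1, ∀ p < d.num,
        s'.real 4 l' (d.row p) = scanResid A τ t l' (τ l') (d.row p) := by
  refine Run.cost_le (Run.seq (run_accumRows hs.loaded (by decide)
    (fun p => A (d.row p) (d.col p) * A (τ l) (d.col p)) ?_) fun s₁ hf₁ h₁ =>
      Run.seq (Run.forLoop (N := l) (d := d.num * 44 + 8)
        (fun u s' => ∀ p < d.num, s'.real 3 u (d.row p) = scanResid A τ t u (τ l) (d.row p))
        rfl ?_ ?_ (fun _ _ _ h => h) ?_) fun s₂ hf₂ h₂ =>
      (run_assignRows (i₀ := l) (hs.frame hf₁ rfl |>.frame hf₂ rfl).loaded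
        (fun j => scanResid A τ t l (τ l) j) ?_ ?_).mono le_rfl ?_) ?_
  · intro p hp s' hc hsame
    have h := hs.congr (hsame.nat 0 (by decide)) (hsame.nat 1 (by decide)) (hsame.nat 2 (by decide))
      (hsame.nat 3 (by decide)) (hsame.nat 7 (by decide)) (hsame.nat 8 (by decide))
      (hsame.real 1 (by decide)) (hsame.real 2 (by decide))
    have h6 : s'.nat 6 0 = l := by rw [hsame.nat 6 (by decide), hstep]
    simp only [RExpr.eval, NExpr.eval, valExpr, entryIdx, stepIdx, colExpr, hc, h6,
      h.loaded.val p hp, h.loaded.col p hp, h.sel l hl, h.mat]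
  · intro s' hf
    simp [stepIdx, NExpr.eval, hf.1 6 rfl, hf₁.1 6 rfl, hstep]
  · intro p hp
    rw [h₁.1 p hp, d.sum_row_eq]
    rfl
  · intro u hu s' hf hc hJ
    have hs' := (hs.frame hf₁ rfl).frame hf rfl
    have h6 : s'.nat 6 0 = l := by rw [hf.1 6 rfl, hf₁.1 6 rfl, hstep]
    have hr4 : s'.real 4 = s.real 4 := by rw [hf.2 4 rfl, hf₁.2 4 rfl]
    have hr6 : s'.real 6 = s.real 6 := by rw [hf.2 6 rfl, hf₁.2 6 rfl]
    refine (run_assignRows (i₀ := u + 1) hs'.loaded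
      (fun j => scanResid A τ t (u + 1) (τ l) j) ?_ ?_).mono (le_of_eq rfl) fun _ _ h => h.1
    · intro s'' hn
      simp [NExpr.eval, pivotIdx, hn 5 (by decide), hc]
    · intro p hp s'' hc' hsame
      have h5 : s''.nat 5 0 = u := by rw [hsame.nat 5 (by decide), hc]
      have h6' : s''.nat 6 0 = l := by rw [hsame.nat 6 (by decide), h6]
      have h3 : s''.nat 3 l = τ l := by rw [hsame.nat 3 (by decide), hs'.sel l hl]
      have h1 : s''.nat 1 p = d.row p := by rw [hsame.nat 1 (by decide), hs'.loaded.row p hp]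
      obtain ⟨p', hp', hτ⟩ := hs.row l hl
      simp only [RExpr.eval, NExpr.eval, rowExpr, entryIdx, pivotIdx, stepIdx, hc', h5, h6', h3, h1]
      rw [hsame.off u _ (by omega), hsame.real 6 (by decide), hsame.real 4 (by decide), hr4, hr6,
        hJ p hp, hg u hu, hZ u hu p hp, ← hτ, hZ u hu p' hp', hτ, scanResid_succ]
  · intro s' hn
    simp [NExpr.eval, stepIdx, hn 6 (by decide), hf₂.1 6 rfl, hf₁.1 6 rfl, hstep]
  · intro p hp s' hc hsame
    have hs' := (hs.frame hf₁ rfl).frame hf₂ rfl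
    have h6 : s'.nat 6 0 = l := by
      rw [hsame.nat 6 (by decide), hf₂.1 6 rfl, hf₁.1 6 rfl, hstep]
    have h1 : s'.nat 1 p = d.row p := by rw [hsame.nat 1 (by decide), hs'.loaded.row p hp]
    simp only [RExpr.eval, NExpr.eval, rowExpr, entryIdx, stepIdx, hc, h6, h1]
    rw [hsame.real 3 (by decide), h₂ p hp]
  · intro s' hf h l' hl' p hp
    rcases Nat.lt_succ_iff_lt_or_eq.1 hl' with h' | rfl
    · rw [← hZ l' h' p hp]
      rw [h.2.off l' _ (by omega), hf₂.2 4 rfl, hf₁.2 4 rfl]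
    · exact h.1 p hp
  · simp only [RExpr.cost, NExpr.cost, valExpr, entryIdx, stepIdx, colExpr, rowExpr]
    apply le_of_eq
    ring

theorem run_pivotCoef {τ : ℕ → Fin m} {q t l : ℕ} {s : Mem} (hs : d.Ready τ q t s) (hl : l < q)
    (hstep : s.nat 6 0 = l)
    (hZ : ∀ p < d.num, s.real 4 l (d.row p) = scanResid A τ t l (τ l) (d.row p))
    (hD : s.real 7 0 0 = pivotProd (A * Aᵀ) (skipList τ t l)) :
    Run pivotCoef s 36 fun s' => s'.real 6 l 0 = elimCoef (A * Aᵀ) τ t l ∧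
      (∀ l' j, l' ≠ l → s'.real 6 l' j = s.real 6 l' j) ∧
      s'.real 7 0 0 = pivotProd (A * Aᵀ) (skipList τ t (l + 1)) := by
  obtain ⟨p, hp, hτ⟩ := hs.row l hl
  have hpiv : s.real 4 l (τ l) = scanResid A τ t l (τ l) (τ l) := by rw [← hτ, hZ p hp, hτ]
  refine Run.cost_le (Run.ite (c := 28) (fun hb => ?_) fun hb => ?_) (by decide)
  · have hlt : l = t := by simpa [Test.Holds, NExpr.eval, stepIdx, posIdx, hstep, hs.pos] using hb
    refine Run.cost_le (Run.setReal ?_) (by decide)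
    simp only [RExpr.eval, NExpr.eval, stepIdx, hstep]
    refine ⟨by simp [elimCoef, hlt], fun l' j hl' => by simp [hl'], ?_⟩
    simp [hD, skipList, hlt]
  · have hlt : ¬ l = t := by simpa [Test.Holds, NExpr.eval, stepIdx, posIdx, hstep, hs.pos] using hb
    refine Run.cost_le (Run.seq (Run.setReal (Q := fun s' => s' = s.writeReal 6 l 0
      (elimCoef (A * Aᵀ) τ t l)) ?_) fun s₁ _ h₁ => Run.setReal ?_) (by decide)
    -- Machine division and `⁻¹` share the convention at zero, so a zero pivot needs no separate
    -- case.
    · simp only [RExpr.eval, NExpr.eval, stepIdx, hstep, hs.sel l hl, hpiv, elimCoef, if_neg hlt]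
      simp [scanResid]
    · subst h₁
      simp only [RExpr.eval, NExpr.eval, stepIdx, Mem.writeReal_nat, hstep, hs.sel l hl]
      refine ⟨by simp, fun l' j hl' => by simp [hl'], ?_⟩
      simp [hD, skipList, hlt, hpiv, pivotProd, scanResid]

/-- The state of a scan after the elimination of `l` rows. -/
structure Entries.ScanInv (d : Entries A) (τ : ℕ → Fin m) (t l : ℕ) (s : Mem) : Prop where
  row : ∀ l' < l, ∀ p < d.num, s.real 4 l' (d.row p) = scanResid A τ t l' (τ l') (d.row p)
  coef : ∀ l' < l, s.real 6 l' 0 = elimCoef (A * Aᵀ) τ t l'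
  diag : ∀ p < d.num, s.real 5 l (d.row p) = scanResid A τ t l (d.row p) (d.row p)
  prod : s.real 7 0 0 = pivotProd (A * Aᵀ) (skipList τ t l)

theorem run_pivotStep {τ : ℕ → Fin m} {q t l : ℕ} {s : Mem} (hs : d.Ready τ q t s) (hl : l < q)
    (hstep : s.nat 6 0 = l) (h : d.ScanInv τ t l s) :
    Run pivotStep s (d.num * (120 + 44 * l) + 19 * l + 80) (d.ScanInv τ t (l + 1)) := by
  refine Run.cost_le (Run.seq (run_pivotRow hs hl hstep h.row h.coef) fun s₁ hf₁ h₁ =>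
    Run.seq (run_pivotCoef (l := l) (hs.frame hf₁ rfl) hl (by rw [hf₁.1 6 rfl, hstep])
      (h₁ l (Nat.lt_succ_self l)) (by rw [hf₁.2 7 rfl, h.prod])) fun s₂ hf₂ h₂ =>
    (run_assignRows (i₀ := l + 1) ((hs.frame hf₁ rfl).frame hf₂ rfl).loaded
      (fun j => scanResid A τ t (l + 1) j j) ?_ ?_).mono le_rfl ?_) ?_
  · intro s' hn
    simp [NExpr.eval, stepIdx, hn 6 (by decide), hf₂.1 6 rfl, hf₁.1 6 rfl, hstep]
  · intro p hp s' hc hsame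
    have hs' := (hs.frame hf₁ rfl).frame hf₂ rfl
    have h6 : s'.nat 6 0 = l := by
      rw [hsame.nat 6 (by decide), hf₂.1 6 rfl, hf₁.1 6 rfl, hstep]
    have h1 : s'.nat 1 p = d.row p := by rw [hsame.nat 1 (by decide), hs'.loaded.row p hp]
    simp only [RExpr.eval, NExpr.eval, rowExpr, entryIdx, stepIdx, hc, h6, h1]
    rw [hsame.off l _ (by omega), hsame.real 6 (by decide), hsame.real 4 (by decide), h₂.1,
      hf₂.2 4 rfl, h₁ l (Nat.lt_succ_self l) p hp, hf₂.2 5 rfl, hf₁.2 5 rfl, h.diag p hp,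
      scanResid_succ]
  · intro s' hf h'
    refine ⟨fun l' hl' p hp => ?_, fun l' hl' => ?_, h'.1, ?_⟩
    · rw [h'.2.real 4 (by decide), hf₂.2 4 rfl, h₁ l' hl' p hp]
    · rw [h'.2.real 6 (by decide)]
      rcases Nat.lt_succ_iff_lt_or_eq.1 hl' with hlt | rfl
      · rw [h₂.2.1 l' 0 hlt.ne, hf₁.2 6 rfl, h.coef l' hlt]
      · exact h₂.1
    · rw [h'.2.real 7 (by decide), h₂.2.2]
  · simp only [RExpr.cost, NExpr.cost, stepIdx, rowExpr, entryIdx]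
    ring_nf
    omega

/-- The determinant obtained by adding the row `j` to the rows that are not skipped (or zero, if it
is among them). -/
noncomputable def score (A : Matrix (Fin m) (Fin n) ℝ) (τ : ℕ → Fin m) (q t : ℕ) (j : Fin m) : ℝ :=
  pivotProd (A * Aᵀ) (skipList τ t q) * scanResid A τ t q j j

/-- The best value, the selected row and its position after the comparison of the rows of the first
`P` entries. -/
structure Entries.Compared (d : Entries A) (τ : ℕ → Fin m) (q t : ℕ) (s : Mem) (P : ℕ) (s' : Mem) :
    Prop where
  le : s.real 8 0 0 ≤ s'.real 8 0 0
  ge : ∀ p < P, score A τ q t (d.row p) ≤ s'.real 8 0 0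
  alt : (s'.real 8 0 0 = s.real 8 0 0 ∧ s'.nat 9 0 = s.nat 9 0 ∧ s'.nat 10 0 = s.nat 10 0) ∨
    (s.real 8 0 0 < s'.real 8 0 0 ∧ s'.nat 10 0 = t ∧
      ∃ p < P, s'.real 8 0 0 = score A τ q t (d.row p) ∧ s'.nat 9 0 = d.row p)

theorem run_updateBest {τ : ℕ → Fin m} {q t p : ℕ} {s₀ s : Mem} (hs : d.Ready τ q t s)
    (hp : p < d.num) (hc : s.nat 4 0 = p)
    (hdiag : s.real 5 q (d.row p) = scanResid A τ t q (d.row p) (d.row p))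
    (hprod : s.real 7 0 0 = pivotProd (A * Aᵀ) (skipList τ t q))
    (h : d.Compared τ q t s₀ p s) : Run updateBest s 50 (d.Compared τ q t s₀ (p + 1)) := by
  have hrow : s.nat 1 p = d.row p := hs.loaded.row p hp
  have hscore : scoreExpr.eval s = score A τ q t (d.row p) := by
    simp only [scoreExpr, RExpr.eval, NExpr.eval, lenExpr, rowExpr, entryIdx, hc, hs.len, hrow,
      hdiag, hprod, score]
  have hcur : RExpr.eval s (.get 8 (.const 0) (.const 0)) = s.real 8 0 0 := rfl
  refine Run.cost_le (Run.ite (c := 36) (fun hb => ?_) fun hb => ?_) (by decide)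
  · rw [Test.Holds, hscore, hcur] at hb
    refine Run.cost_le (Run.seq (Run.setReal (Q := fun s' => s' = s.writeReal 8 0 0
      (score A τ q t (d.row p))) (by rw [hscore]; rfl)) fun s₁ _ h₁ =>
      Run.seq (Run.setNat (Q := fun s' => s' = s₁.writeNat 9 0 (d.row p)) ?_) fun s₂ _ h₂ =>
      Run.setNat ?_) (by decide)
    · simp [NExpr.eval, rowExpr, entryIdx, h₁, hc, hrow]
    · subst h₂
      subst h₁
      have ht : s.nat 7 0 = t := hs.pos
      refine ⟨?_, ?_, Or.inr ⟨?_, ?_, p, Nat.lt_succ_self p, ?_, ?_⟩⟩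
      · simpa using h.le.trans hb.le
      · intro p' hp'
        rcases Nat.lt_succ_iff_lt_or_eq.1 hp' with hlt | rfl
        · simpa using (h.ge p' hlt).trans hb.le
        · simp
      · simpa using h.le.trans_lt hb
      · simp [NExpr.eval, posIdx, ht]
      · simp
      · simp [NExpr.eval]
  · rw [Test.Holds, hscore, hcur, not_lt] at hb
    refine Run.cost_le (Run.skip ⟨h.le, fun p' hp' => ?_, ?_⟩) (by decide)
    · rcases Nat.lt_succ_iff_lt_or_eq.1 hp' with hlt | rfl
      · exact h.ge p' hlt
      · exact hb
    · rcases h.alt with h' | ⟨h1, h2, p', hp', h3⟩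
      · exact Or.inl h'
      · exact Or.inr ⟨h1, h2, p', by omega, h3⟩

theorem run_scan {τ : ℕ → Fin m} {q t : ℕ} {s : Mem} (hs : d.Ready τ q t s) :
    Run scan s (q * (d.num * (120 + 44 * q) + 19 * q + 91) + d.num * 120 + 50)
      (d.Compared τ q t s d.num) := by
  have hfr : ∀ s' s'', Frame (forLoop 6 lenExpr pivotStep) s' s'' →
      d.Ready τ q t s' → d.Ready τ q t s'' := fun s' s'' hf h => h.frame hf rfl
  refine Run.cost_le (Run.seq (run_accumRows hs.loaded (by decide)
    (fun p => A (d.row p) (d.col p) * A (d.row p) (d.col p)) ?_) fun s₁ hf₁ h₁ =>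
    Run.seq (Run.setReal (Q := fun s' => s' = s₁.writeReal 7 0 0 1) ?_) fun s₂ hf₂ h₂ =>
    Run.seq (Run.forLoop (N := q) (d := d.num * (120 + 44 * q) + 19 * q + 80)
      (fun l s' => d.ScanInv τ t l s') rfl ?_ ?_
      (fun _ _ _ h => ⟨h.row, h.coef, h.diag, h.prod⟩) ?_) fun s₃ hf₃ h₃ =>
    Run.forLoop (N := d.num) (d := 50) (fun p s' => d.Compared τ q t s p s') rfl ?_ ?_
      (fun _ _ _ h => ⟨h.le, h.ge, by simpa using h.alt⟩) ?_) ?_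
  · intro p hp s' hc hsame
    have hl := hs.loaded.congr (hsame.nat 0 (by decide)) (hsame.nat 1 (by decide))
      (hsame.nat 2 (by decide)) (hsame.real 1 (by decide))
    simp only [RExpr.eval, NExpr.eval, valExpr, entryIdx, hc, hl.val p hp]
  · simp [RExpr.eval, NExpr.eval]
  · intro s' hf
    have := (((hs.frame hf₁ rfl).frame hf₂ rfl).frame hf rfl).len
    simp [lenExpr, NExpr.eval, this]
  · refine ⟨fun l' hl' => absurd hl' (Nat.not_lt_zero l'),
      fun l' hl' => absurd hl' (Nat.not_lt_zero l'), fun p hp => ?_, ?_⟩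
    · rw [hf₂.2 5 rfl, h₁.1 p hp]
      refine (Finset.sum_congr rfl fun p' _ => ?_).trans (d.sum_row_eq (d.row p) (d.row p))
      split_ifs with hr
      · rw [hr]
      · rfl
    · simp [h₂, skipList, pivotProd]
  · intro l hl s' hf hc h
    have hs' := (((hs.frame hf₁ rfl).frame hf₂ rfl).frame hf rfl)
    refine (run_pivotStep hs' hl hc h).cost_le ?_
    gcongr
  · intro s' hf
    have := ((((hs.frame hf₁ rfl).frame hf₂ rfl).frame hf₃ rfl).frame hf rfl).loaded.num
    simp [numExpr, NExpr.eval, this]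
  · have e8 : s₃.real 8 = s.real 8 := by rw [hf₃.2 8 rfl, hf₂.2 8 rfl, hf₁.2 8 rfl]
    have e9 : s₃.nat 9 = s.nat 9 := by rw [hf₃.1 9 rfl, hf₂.1 9 rfl, hf₁.1 9 rfl]
    have e10 : s₃.nat 10 = s.nat 10 := by rw [hf₃.1 10 rfl, hf₂.1 10 rfl, hf₁.1 10 rfl]
    exact ⟨by rw [e8], fun p hp => absurd hp (Nat.not_lt_zero p),
      Or.inl ⟨by rw [e8], by rw [e9], by rw [e10]⟩⟩
  · intro p hp s' hf hc h
    have hs' := ((((hs.frame hf₁ rfl).frame hf₂ rfl).frame hf₃ rfl).frame hf rfl)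
    exact run_updateBest hs' hp hc (by rw [hf.2 5 rfl, h₃.diag p hp]) (by rw [hf.2 7 rfl, h₃.prod]) h
  · simp only [RExpr.cost, NExpr.cost, valExpr, entryIdx, lenExpr, numExpr]
    ring_nf
    omega

end Scan

/-! ### Scores as determinants of greedy extensions and swaps. -/

section ScoreFacts

variable {m n : ℕ} {A : Matrix (Fin m) (Fin n) ℝ} {d : Entries A}

/-- The set of the first `q` values of `τ`. -/
def firstSet (τ : ℕ → Fin m) (q : ℕ) : Finset (Fin m) := (Finset.range q).image τ

theorem mem_firstSet {τ : ℕ → Fin m} {q : ℕ} {x : Fin m} :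
    x ∈ firstSet τ q ↔ ∃ l < q, τ l = x := by
  simp [firstSet]

theorem toFinset_skipList_self (τ : ℕ → Fin m) (q : ℕ) :
    (skipList τ q q).toFinset = firstSet τ q := by
  ext x
  rw [List.mem_toFinset, mem_skipList, mem_firstSet]
  exact ⟨fun ⟨l, h1, _, h2⟩ => ⟨l, h1, h2⟩, fun ⟨l, h1, h2⟩ => ⟨l, h1, h1.ne, h2⟩⟩

theorem toFinset_skipList {τ : ℕ → Fin m} {q t : ℕ} (hτ : Set.InjOn τ (Set.Iio q)) (ht : t < q) :
    (skipList τ t q).toFinset = (firstSet τ q).erase (τ t) := by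
  ext x
  rw [List.mem_toFinset, mem_skipList, Finset.mem_erase, mem_firstSet]
  constructor
  · rintro ⟨l, h1, h2, rfl⟩
    exact ⟨fun h => h2 (hτ h1 ht h), l, h1, rfl⟩
  · rintro ⟨h, l, h1, rfl⟩
    exact ⟨l, h1, fun hlt => h (by rw [hlt]), rfl⟩

theorem score_eq_zero_of_mem {τ : ℕ → Fin m} {q t : ℕ} {j : Fin m}
    (hj : j ∈ (skipList τ t q).toFinset) : score A τ q t j = 0 := by
  rw [score, scanResid, resid_apply_of_mem (posSemidef_gram A) (List.mem_toFinset.1 hj), mul_zero]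

theorem score_eq {τ : ℕ → Fin m} {q t : ℕ} (hτ : Set.InjOn τ (Set.Iio q)) {j : Fin m}
    (hj : j ∉ (skipList τ t q).toFinset) :
    score A τ q t j = detRows A (insert j (skipList τ t q).toFinset) := by
  rw [score, scanResid, detRows_eq_minor, minor_insert_toFinset (posSemidef_gram A)
    (nodup_skipList hτ) (fun h => hj (List.mem_toFinset.2 h))]

/-- A row without entries is zero and has score `0`, so a nonnegative bound over the listed rows
holds for all rows. -/
theorem score_le {τ : ℕ → Fin m} {q t : ℕ} {b : ℝ} (hb : 0 ≤ b)
    (h : ∀ p < d.num, score A τ q t (d.row p) ≤ b) (j : Fin m) : score A τ q t j ≤ b := by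
  by_cases hj : ∃ p < d.num, d.row p = j
  · obtain ⟨p, hp, rfl⟩ := hj
    exact h p hp
  · refine le_trans (le_of_eq ?_) hb
    have hA : ∀ c, A j c = 0 := fun c => by
      by_contra hne
      obtain ⟨p, hp, hr, -⟩ := d.exists_of_ne_zero hne
      exact hj ⟨p, hp, hr⟩
    have hL := posSemidef_gram A
    have h1 := resid_diag_le hL (skipList τ t q) j
    have h2 : (A * Aᵀ) j j = 0 := by simp [mul_apply, hA]
    have h3 : scanResid A τ t q j j = 0 :=
      le_antisymm (h1.trans h2.le) (resid_posSemidef hL _).diag_nonneg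
    rw [score, h3, mul_zero]

theorem injOn_update {τ : ℕ → Fin m} {q t : ℕ} {S : Set ℕ} (hτ : Set.InjOn τ S)
    (hS : ∀ l, l < q → l ≠ t → l ∈ S) {j : Fin m} (hj : ∀ l, l < q → l ≠ t → τ l ≠ j) :
    Set.InjOn (Function.update τ t j) (Set.Iio q) := by
  intro a ha b hb hab
  by_cases h1 : a = t <;> by_cases h2 : b = t
  · rw [h1, h2]
  · rw [h1, Function.update_self, Function.update_of_ne h2] at hab
    exact absurd hab.symm (hj b hb h2)
  · rw [h2, Function.update_self, Function.update_of_ne h1] at hab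
    exact absurd hab (hj a ha h1)
  · rw [Function.update_of_ne h1, Function.update_of_ne h2] at hab
    exact hτ (hS a ha h1) (hS b hb h2) hab

theorem firstSet_update_succ (τ : ℕ → Fin m) (t : ℕ) (j : Fin m) :
    firstSet (Function.update τ t j) (t + 1) = insert j (firstSet τ t) := by
  ext x
  simp only [mem_firstSet, Finset.mem_insert]
  constructor
  · rintro ⟨l, h1, h2⟩
    rcases Nat.lt_succ_iff_lt_or_eq.1 h1 with hlt | rfl
    · rw [Function.update_of_ne hlt.ne] at h2
      exact Or.inr ⟨l, hlt, h2⟩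
    · rw [Function.update_self] at h2
      exact Or.inl h2.symm
  · rintro (rfl | ⟨l, h1, rfl⟩)
    · exact ⟨t, Nat.lt_succ_self t, Function.update_self ..⟩
    · exact ⟨l, by omega, Function.update_of_ne h1.ne ..⟩

theorem firstSet_update {τ : ℕ → Fin m} {q t : ℕ} (hτ : Set.InjOn τ (Set.Iio q)) (ht : t < q)
    (j : Fin m) : firstSet (Function.update τ t j) q = swap (firstSet τ q) (τ t) j := by
  ext x
  simp only [swap, mem_firstSet, Finset.mem_insert, Finset.mem_erase]
  constructor
  · rintro ⟨l, h1, h2⟩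
    by_cases hl : l = t
    · rw [hl, Function.update_self] at h2
      exact Or.inl h2.symm
    · rw [Function.update_of_ne hl] at h2
      exact Or.inr ⟨fun h => hl (hτ h1 ht (h2.trans h)), l, h1, h2⟩
  · rintro (rfl | ⟨h, l, h1, rfl⟩)
    · exact ⟨t, ht, Function.update_self ..⟩
    · exact ⟨l, h1, Function.update_of_ne (fun hl => h (by rw [hl])) ..⟩

/-- Skipping position `t` among the first `t` skips nothing. Selected rows have score zero, so a
positive score means a new row. -/
theorem isGreedy_of_score {τ : ℕ → Fin m} {t : ℕ} (hτ : Set.InjOn τ (Set.Iio t))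
    (hg : IsGreedy A t (firstSet τ t)) {j : Fin m} (hpos : 0 < score A τ t t j)
    (hmax : ∀ i, score A τ t t i ≤ score A τ t t j) :
    j ∉ firstSet τ t ∧ IsGreedy A (t + 1) (insert j (firstSet τ t)) ∧
      score A τ t t j = detRows A (insert j (firstSet τ t)) := by
  have key : ∀ i, i ∉ firstSet τ t → score A τ t t i = detRows A (insert i (firstSet τ t)) := by
    intro i hi
    rw [← toFinset_skipList_self] at hi ⊢
    exact score_eq hτ hi
  have hj : j ∉ firstSet τ t := fun h => by
    rw [← toFinset_skipList_self] at h
    rw [score_eq_zero_of_mem h] at hpos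
    exact lt_irrefl _ hpos
  refine ⟨hj, .step hg hj fun i hi => ?_, key j hj⟩
  rw [← key i hi, ← key j hj]
  exact hmax i

theorem exists_score_pos {τ : ℕ → Fin m} {t : ℕ} (hτ : Set.InjOn τ (Set.Iio t))
    (hg : IsGreedy A t (firstSet τ t)) (ht : t < A.rank) : ∃ j, 0 < score A τ t t j := by
  have hL := posSemidef_gram A
  have hnd := nodup_skipList (t := t) hτ
  have hlen : (skipList τ t t).length = t := by
    rw [← List.toFinset_card_of_nodup hnd, toFinset_skipList_self, hg.card_eq]
  obtain ⟨j, hj⟩ := exists_resid_pos hL (W := skipList τ t t)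
    (by rw [rank_self_mul_transpose]; omega)
  have hpos := hg.detRows_pos ht.le
  rw [← toFinset_skipList_self, detRows_eq_minor, minor_toFinset hL hnd] at hpos
  exact ⟨j, mul_pos hpos hj⟩

variable {k : ℕ} {ε : ℝ}

theorem score_eq_swap {τ : ℕ → Fin m} {t : ℕ} (hτ : Set.InjOn τ (Set.Iio k)) (ht : t < k)
    {j : Fin m} (hj : j ∉ firstSet τ k) :
    score A τ k t j = detRows A (swap (firstSet τ k) (τ t) j) := by
  rw [score_eq hτ, toFinset_skipList hτ ht, swap]
  rw [toFinset_skipList hτ ht]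
  exact fun h => hj (Finset.mem_of_mem_erase h)

/-- Adding back the skipped row restores the current set, and any other selected row scores zero. So
a scan over all rows cannot mistake a selected row for an improving swap. -/
theorem score_le_of_mem {τ : ℕ → Fin m} {t : ℕ} (hτ : Set.InjOn τ (Set.Iio k)) (ht : t < k)
    {j : Fin m} (hj : j ∈ firstSet τ k) : score A τ k t j ≤ detRows A (firstSet τ k) := by
  by_cases h : j = τ t
  · subst h
    rw [score_eq hτ, toFinset_skipList hτ ht, Finset.insert_erase hj]
    rw [toFinset_skipList hτ ht]
    exact Finset.notMem_erase _ _
  · rw [score_eq_zero_of_mem]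
    · exact detRows_nonneg A _
    · rw [toFinset_skipList hτ ht]
      exact Finset.mem_erase.2 ⟨h, hj⟩

theorem swapStep_of_score {τ : ℕ → Fin m} {t : ℕ} (hε : 0 < ε)
    (hτ : Set.InjOn τ (Set.Iio k)) (ht : t < k) {j : Fin m}
    (hlt : (1 + ε / (k : ℝ)) * detRows A (firstSet τ k) < score A τ k t j)
    (hmax : ∀ t' < k, ∀ i, score A τ k t' i ≤ score A τ k t j) :
    j ∉ firstSet τ k ∧ SwapStep A k ε (firstSet τ k) (swap (firstSet τ k) (τ t) j) ∧
      score A τ k t j = detRows A (swap (firstSet τ k) (τ t) j) := by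
  have hj : j ∉ firstSet τ k := fun h => by
    have h1 := score_le_of_mem (A := A) hτ ht h
    have h2 : 0 ≤ ε / (k : ℝ) * detRows A (firstSet τ k) :=
      mul_nonneg (by positivity) (detRows_nonneg A _)
    linarith
  have hs := score_eq_swap (A := A) hτ ht hj
  refine ⟨hj, ⟨τ t, mem_firstSet.2 ⟨t, ht, rfl⟩, j, hj, rfl, fun i' hi' j' hj' => ?_, ?_⟩, hs⟩
  · obtain ⟨t', ht', rfl⟩ := mem_firstSet.1 hi'
    rw [← hs, ← score_eq_swap hτ ht' hj']
    exact hmax t' ht' j'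
  · rwa [← hs]

theorem stops_of_score {τ : ℕ → Fin m} (hτ : Set.InjOn τ (Set.Iio k))
    (hmax : ∀ t < k, ∀ i, score A τ k t i ≤ (1 + ε / (k : ℝ)) * detRows A (firstSet τ k)) :
    Stops A k ε (firstSet τ k) := by
  rintro S' ⟨i, hi, j, hj, rfl, -, hlt⟩
  obtain ⟨t, ht, rfl⟩ := mem_firstSet.1 hi
  rw [← score_eq_swap hτ ht hj] at hlt
  exact absurd (hmax t ht j) (not_le.2 hlt)

end ScoreFacts

/-! ### The complete program and its invariants. -/

section MainProgram

/-- Length and skipped position are both `t`, so all selected rows are eliminated; starting the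
comparison at `0` admits only positive scores. -/
def greedyStep : Prog :=
  .seq (.setNat 8 (.const 0) posIdx)
    (.seq (.setReal 8 (.const 0) (.const 0) (.ofNat (.const 0)))
      (.seq scan
        (.seq (.setNat 3 posIdx (.get 9 (.const 0)))
          (.setReal 9 (.const 0) (.const 0) (.get 8 (.const 0) (.const 0))))))

def greedyProg : Prog := forLoop 7 sizeExpr greedyStep

/-- Put the value to be exceeded into cell `(0, 0)` of the real array `8`, and scan all swaps. -/
def scanSwaps : Prog :=
  .seq (.setReal 8 (.const 0) (.const 0)
      (.mul (.add (.ofNat (.const 1)) (.div (.get 0 (.const 0) (.const 0)) (.ofNat sizeExpr)))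
        (.get 9 (.const 0) (.const 0))))
    (.seq (.setNat 10 (.const 0) sizeExpr) (forLoop 7 sizeExpr scan))

/-- Make the swap that was found, or lower the flag. -/
def applySwap : Prog :=
  .ite (.natLt (.get 10 (.const 0)) sizeExpr)
    (.seq (.setNat 3 (.get 10 (.const 0)) (.get 9 (.const 0)))
      (.setReal 9 (.const 0) (.const 0) (.get 8 (.const 0) (.const 0))))
    (.setNat 11 (.const 0) (.const 0))

def localStep : Prog := .seq scanSwaps applySwap

def localProg : Prog :=
  .seq (.setNat 8 (.const 0) sizeExpr)
    (.seq (.setNat 11 (.const 0) (.const 1))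
      (.loop (.natLt (.const 0) (.get 11 (.const 0))) localStep))

def mapProg : Prog := .seq scatter (.seq greedyProg localProg)

variable {m n : ℕ} {A : Matrix (Fin m) (Fin n) ℝ} {d : Entries A} {k : ℕ} {ε : ℝ}

/-- The memory holds the input and the distinct rows `τ 0, …, τ (q - 1)`. -/
structure Entries.Holds (d : Entries A) (k : ℕ) (ε : ℝ) (τ : ℕ → Fin m) (q : ℕ) (s : Mem) :
    Prop where
  loaded : d.Loaded s
  size : s.nat 0 0 = k
  eps : s.real 0 0 0 = ε
  mat : ∀ (i : Fin m) (j : Fin n), s.real 2 i j = A i j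
  inj : Set.InjOn τ (Set.Iio q)
  sel : ∀ l < q, s.nat 3 l = τ l
  row : ∀ l < q, ∃ p < d.num, d.row p = τ l

theorem Entries.Holds.frame {τ : ℕ → Fin m} {q : ℕ} {p : Prog} {s s' : Mem}
    (h : d.Holds k ε τ q s) (hf : Frame p s s')
    (hw : ((p.writesNat 0 || p.writesNat 1 || p.writesNat 2 || p.writesNat 3) ||
      (p.writesReal 0 || p.writesReal 1 || p.writesReal 2)) = false) : d.Holds k ε τ q s' := by
  simp only [Bool.or_eq_false_iff] at hw
  obtain ⟨⟨⟨⟨h0, h1⟩, h2⟩, h3⟩, ⟨hr0, hr1⟩, hr2⟩ := hw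
  exact ⟨h.loaded.congr (hf.1 0 h0) (hf.1 1 h1) (hf.1 2 h2) (hf.2 1 hr1),
    by rw [hf.1 0 h0]; exact h.size, by rw [hf.2 0 hr0]; exact h.eps,
    by rw [hf.2 2 hr2]; exact h.mat, h.inj, by rw [hf.1 3 h3]; exact h.sel, h.row⟩

theorem Entries.Holds.ready {τ : ℕ → Fin m} {q t : ℕ} {s : Mem} (h : d.Holds k ε τ q s)
    (hpos : s.nat 7 0 = t) (hlen : s.nat 8 0 = q) : d.Ready τ q t s :=
  ⟨h.loaded, h.mat, h.sel, h.row, hpos, hlen⟩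

/-- Writing one selected row. -/
theorem Entries.Holds.update {τ : ℕ → Fin m} {q q' t p : ℕ} {s : Mem}
    (h : d.Holds k ε τ q s) (hp : p < d.num) (hq : ∀ l < q', l ≠ t → l < q)
    (hj : d.row p ∉ firstSet τ q) :
    d.Holds k ε (Function.update τ t (d.row p)) q' (s.writeNat 3 t (d.row p)) := by
  refine ⟨h.loaded.congr ?_ ?_ ?_ rfl, h.size, h.eps, h.mat, ?_, fun l hl => ?_, fun l hl => ?_⟩
  · funext j; simp
  · funext j; simp
  · funext j; simp
  · exact injOn_update h.inj (fun l h1 h2 => hq l h1 h2)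
      fun l h1 h2 h3 => hj (mem_firstSet.2 ⟨l, hq l h1 h2, h3⟩)
  · by_cases hlt : l = t
    · simp [hlt]
    · simp [hlt, h.sel l (hq l hl hlt)]
  · by_cases hlt : l = t
    · exact ⟨p, hp, by rw [hlt, Function.update_self]⟩
    · rw [Function.update_of_ne hlt]
      exact h.row l (hq l hl hlt)

/-- Upper bound for the number of operations of a scan of at most `k` rows. -/
def scanCost (N k : ℕ) : ℕ := k * (N * (120 + 44 * k) + 19 * k + 91) + N * 120 + 50

theorem run_greedyProg (hr : k ≤ A.rank) {s : Mem} {τ : ℕ → Fin m}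
    (hs : d.Holds k ε τ 0 s) :
    Run greedyProg s (k * (scanCost d.num k + 40) + 8) fun s' => ∃ τ : ℕ → Fin m,
      d.Holds k ε τ k s' ∧ IsGreedy A k (firstSet τ k) ∧
        -- The determinant `1` of the empty set is never stored.
        (k = 0 ∨ s'.real 9 0 0 = detRows A (firstSet τ k)) := by
  refine Run.cost_le (Run.forLoop (N := k) (d := scanCost d.num k + 29) (fun t s' =>
    ∃ τ : ℕ → Fin m, d.Holds k ε τ t s' ∧ IsGreedy A t (firstSet τ t) ∧
      (t = 0 ∨ s'.real 9 0 0 = detRows A (firstSet τ t))) rfl ?_ ?_ ?_ ?_) ?_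
  · intro s' hf
    have : s'.nat 0 = s.nat 0 := hf.1 0 rfl
    simp [sizeExpr, NExpr.eval, this, hs.size]
  · exact ⟨τ, hs, .start, Or.inl rfl⟩
  · rintro i s' v ⟨τ, h1, h2⟩
    exact ⟨τ, h1.frame (frame_of_exec (Exec.setNat s' 7 (.const 0) (.const v))) rfl, h2⟩
  · rintro t ht s' - hc ⟨τ, hτ, hg, -⟩
    refine Run.cost_le (Run.seq (Run.setNat (Q := fun s₁ => s₁.nat 8 0 = t)
      (by simp [NExpr.eval, posIdx, hc])) fun s₁ hf₁ h₁ =>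
      Run.seq (Run.setReal (Q := fun s₂ => s₂.real 8 0 0 = 0)
        (by simp [RExpr.eval, NExpr.eval])) fun s₂ hf₂ h₂ =>
      Run.seq (c' := 14) (run_scan (τ := τ) (q := t) (t := t) (((hτ.frame hf₁ rfl).frame hf₂ rfl).ready ?_ ?_))
        fun s₃ hf₃ h₃ => ?_) ?_
    · rw [hf₂.1 7 rfl, hf₁.1 7 rfl, hc]
    · rw [hf₂.1 8 rfl, h₁]
    · have hτ₃ := ((hτ.frame hf₁ rfl).frame hf₂ rfl).frame hf₃ rfl
      have hc₃ : s₃.nat 7 0 = t := by rw [hf₃.1 7 rfl, hf₂.1 7 rfl, hf₁.1 7 rfl, hc]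
      -- Below the rank some score is positive, so the scan must have recorded a row.
      obtain ⟨j, hj⟩ := exists_score_pos hτ.inj hg (ht.trans_le hr)
      have h0 : 0 ≤ s₃.real 8 0 0 := h₂ ▸ h₃.le
      have hle := score_le h0 h₃.ge
      rcases h₃.alt with ⟨h4, -⟩ | ⟨h4, -, p, hp, h5, h6⟩
      · rw [h₂] at h4
        exact absurd (hle j) (not_le.2 (h4 ▸ hj))
      · rw [h₂, h5] at h4
        rw [h5] at hle
        obtain ⟨h7, h8, h9⟩ := isGreedy_of_score hτ.inj hg h4 hle
        refine Run.cost_le (Run.seq (Run.setNat (Q := fun s₄ => s₄ = s₃.writeNat 3 t (d.row p)) ?_)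
          fun s₄ hf₄ h₄ => (Run.setReal (Q := fun s' => s'.real 9 0 0 =
            detRows A (insert (d.row p) (firstSet τ t))) ?_).mono le_rfl fun s₅ hf₅ h₁₀ => ?_)
          (by decide)
        · simp [NExpr.eval, posIdx, hc₃, h6]
        · simp [RExpr.eval, NExpr.eval, h₄, h5, h9]
        · have hH : d.Holds k ε (Function.update τ t (d.row p)) (t + 1) s₄ := by
            rw [h₄]
            exact hτ₃.update hp (fun l h1 h2 => by omega) h7
          refine ⟨_, hH.frame hf₅ rfl, ?_, Or.inr ?_⟩ <;> rw [firstSet_update_succ]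
          · exact h8
          · exact h₁₀
    · have : t * (d.num * (120 + 44 * t) + 19 * t + 91) ≤
          k * (d.num * (120 + 44 * k) + 19 * k + 91) := by gcongr
      simp only [scanCost, NExpr.cost, RExpr.cost, posIdx]
      omega
  · simp only [NExpr.cost, sizeExpr]
    exact le_of_eq (by ring)

/-- The result of the comparison of the swaps of the first `t` positions. -/
structure Entries.Swaps (d : Entries A) (τ : ℕ → Fin m) (k t : ℕ) (b : ℝ) (s : Mem) : Prop where
  le : b ≤ s.real 8 0 0
  ge : ∀ t' < t, ∀ p < d.num, score A τ k t' (d.row p) ≤ s.real 8 0 0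
  alt : (s.real 8 0 0 = b ∧ s.nat 10 0 = k) ∨
    (b < s.real 8 0 0 ∧ ∃ t' < t, s.nat 10 0 = t' ∧
      ∃ p < d.num, s.real 8 0 0 = score A τ k t' (d.row p) ∧ s.nat 9 0 = d.row p)

/-- The comparison starts at the acceptance threshold, so a recorded swap is both admissible and
best. The position `k` marks that none was found. -/
theorem run_scanSwaps {s : Mem} {τ : ℕ → Fin m} (hs : d.Holds k ε τ k s) (hlen : s.nat 8 0 = k)
    (hcur : s.real 9 0 0 = detRows A (firstSet τ k)) :
    Run scanSwaps s (k * (scanCost d.num k + 11) + 30)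
      (d.Swaps τ k k ((1 + ε / (k : ℝ)) * detRows A (firstSet τ k))) := by
  set b := (1 + ε / (k : ℝ)) * detRows A (firstSet τ k) with hb
  refine Run.cost_le (Run.seq (Run.setReal (Q := fun s' => s'.real 8 0 0 = b) ?_) fun s₁ hf₁ h₁ =>
    Run.seq (Run.setNat (Q := fun s' => s'.nat 10 0 = k) ?_) fun s₂ hf₂ h₂ =>
    Run.forLoop (N := k) (d := scanCost d.num k) (fun t s' => d.Swaps τ k t b s') rfl ?_ ?_
      (fun _ _ _ h => ⟨h.le, h.ge, by simpa using h.alt⟩) ?_) ?_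
  · simp [RExpr.eval, NExpr.eval, sizeExpr, hs.size, hs.eps, hcur, hb]
  · have := (hs.frame hf₁ rfl).size
    simp [NExpr.eval, sizeExpr, this]
  · intro s' hf
    have := (((hs.frame hf₁ rfl).frame hf₂ rfl).frame hf rfl).size
    simp [NExpr.eval, sizeExpr, this]
  · have h8 : s₂.real 8 0 0 = b := by rw [hf₂.2 8 rfl, h₁]
    exact ⟨h8.ge, fun t' ht' => absurd ht' (Nat.not_lt_zero t'), Or.inl ⟨h8, h₂⟩⟩
  · intro t ht s' hf hc h
    have hs' := ((hs.frame hf₁ rfl).frame hf₂ rfl).frame hf rfl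
    have hlen' : s'.nat 8 0 = k := by rw [hf.1 8 rfl, hf₂.1 8 rfl, hf₁.1 8 rfl, hlen]
    refine (run_scan (hs'.ready hc hlen')).mono le_rfl fun s'' _ h' => ⟨h.le.trans h'.le, ?_, ?_⟩
    · intro t' ht' p hp
      rcases Nat.lt_succ_iff_lt_or_eq.1 ht' with hlt | rfl
      · exact (h.ge t' hlt p hp).trans h'.le
      · exact h'.ge p hp
    · rcases h'.alt with ⟨h1, h2, h3⟩ | ⟨h1, h2, h3⟩
      · rw [h1, h2, h3]
        rcases h.alt with h4 | ⟨h4, t', h5, h6⟩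
        · exact Or.inl h4
        · exact Or.inr ⟨h4, t', by omega, h6⟩
      · exact Or.inr ⟨h.le.trans_lt h1, t, Nat.lt_succ_self t, h2, h3⟩
  · simp only [NExpr.cost, RExpr.cost, sizeExpr]
    ring_nf
    omega

/-- The state of the local search after `N` steps. -/
def Entries.Searching (d : Entries A) (k : ℕ) (ε : ℝ) (N : ℕ) (s : Mem) : Prop :=
  ∃ (τ : ℕ → Fin m) (R : ℕ → Finset (Fin m)), d.Holds k ε τ k s ∧ IsRun A k ε N R ∧
    R N = firstSet τ k ∧ s.real 9 0 0 = detRows A (firstSet τ k) ∧ s.nat 8 0 = k ∧ s.nat 11 0 = 1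

/-- The local search has stopped. -/
def Entries.Stopped (A : Matrix (Fin m) (Fin n) ℝ) (k : ℕ) (ε : ℝ) (s : Mem) : Prop :=
  ∃ τ : ℕ → Fin m, (∀ l < k, s.nat 3 l = τ l) ∧ IsResult A k ε (firstSet τ k) ∧ s.nat 11 0 = 0

theorem run_localStep (hε : 0 < ε) {N : ℕ} {s : Mem} (h : d.Searching k ε N s) :
    Run localStep s (k * (scanCost d.num k + 11) + 60)
      fun s' => d.Searching k ε (N + 1) s' ∨ Entries.Stopped A k ε s' := by
  obtain ⟨τ, R, hs, hR, hRN, hcur, hlen, hflag⟩ := h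
  refine Run.cost_le (Run.seq (run_scanSwaps hs hlen hcur) fun s₁ hf₁ h₁ =>
    Run.ite (c := 14) (fun hb => ?_) fun hb => ?_) ?_
  · have hs₁ := hs.frame hf₁ rfl
    have hb0 : 0 ≤ (1 + ε / (k : ℝ)) * detRows A (firstSet τ k) :=
      mul_nonneg (by positivity) (detRows_nonneg A _)
    have hle : ∀ t' < k, ∀ i, score A τ k t' i ≤ s₁.real 8 0 0 := fun t' ht' =>
      score_le (hb0.trans h₁.le) (h₁.ge t' ht')
    have hb' : s₁.nat 10 0 < k := by
      simpa [Test.Holds, NExpr.eval, sizeExpr, hs₁.size] using hb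
    rcases h₁.alt with ⟨-, h2⟩ | ⟨h2, t, ht, h3, p, hp, h4, h5⟩
    · omega
    · rw [h4] at h2 hle
      obtain ⟨h6, h7, h8⟩ := swapStep_of_score hε hs.inj ht h2 hle
      refine Run.cost_le (Run.seq (Run.setNat (Q := fun s₂ => s₂ = s₁.writeNat 3 t (d.row p)) ?_)
        fun s₂ hf₂ h₂ => (Run.setReal (Q := fun s' => s'.real 9 0 0 =
          detRows A (swap (firstSet τ k) (τ t) (d.row p))) ?_).mono le_rfl
          fun s₃ hf₃ h₉ => Or.inl ?_) (by decide)
      · simp [NExpr.eval, h3, h5]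
      · simp [RExpr.eval, NExpr.eval, h₂, h4, h8]
      · have hH : d.Holds k ε (Function.update τ t (d.row p)) k s₂ := by
          rw [h₂]
          exact hs₁.update hp (fun l h1 _ => h1) h6
        rw [← firstSet_update hs.inj ht, ← hRN] at h7
        refine ⟨_, _, hH.frame hf₃ rfl, hR.snoc h7, by rw [Function.update_self], ?_, ?_, ?_⟩
        · rw [h₉, firstSet_update hs.inj ht]
        · rw [hf₃.1 8 rfl, hf₂.1 8 rfl, hf₁.1 8 rfl, hlen]
        · rw [hf₃.1 11 rfl, hf₂.1 11 rfl, hf₁.1 11 rfl, hflag]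
  · have hs₁ := hs.frame hf₁ rfl
    have hb' : ¬ s₁.nat 10 0 < k := by
      simpa [Test.Holds, NExpr.eval, sizeExpr, hs₁.size] using hb
    rcases h₁.alt with ⟨h2, -⟩ | ⟨-, t, ht, h3, -⟩
    · refine Run.cost_le (Run.setNat (Or.inr ⟨τ, fun l hl => ?_, ⟨N, R, hR, hRN, ?_⟩, ?_⟩))
        (by decide)
      · simp [hs₁.sel l hl]
      · have hb0 : 0 ≤ (1 + ε / (k : ℝ)) * detRows A (firstSet τ k) :=
          mul_nonneg (by positivity) (detRows_nonneg A _)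
        exact stops_of_score hs.inj fun t ht => score_le hb0 (fun p hp => h2 ▸ h₁.ge t ht p hp)
      · simp [NExpr.eval]
    · omega
  · simp only [Test.cost, NExpr.cost, sizeExpr]
    omega

/-- The loop invariant carries a run of the abstract algorithm, so the bound `M` on run lengths
bounds the iterations. -/
theorem run_localProg (hε : 0 < ε) {M : ℕ}
    (hM : ∀ N R, IsRun A k ε N R → N ≤ M) {s : Mem} {τ : ℕ → Fin m} (hs : d.Holds k ε τ k s)
    (hg : IsGreedy A k (firstSet τ k)) (hcur : s.real 9 0 0 = detRows A (firstSet τ k)) :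
    Run localProg s ((M + 1) * (k * (scanCost d.num k + 11) + 64) + 20)
      (Entries.Stopped A k ε) := by
  refine Run.cost_le (Run.seq (Run.setNat (Q := fun s' => s'.nat 8 0 = k) ?_) fun s₁ hf₁ h₁ =>
    Run.seq (Run.setNat (Q := fun s' => s'.nat 11 0 = 1) ?_) fun s₂ hf₂ h₂ =>
    Run.loop (M := M) (I := d.Searching k ε) (fun N s' h => ?_) (fun N s' h => ?_)
      (fun N s' h => run_localStep hε h) (fun s' h => ?_) ?_) ?_
  · simp [NExpr.eval, sizeExpr, hs.size]
  · simp [NExpr.eval]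
  · obtain ⟨-, R, -, hR, -⟩ := h
    exact hM N R hR
  · obtain ⟨-, -, -, -, -, -, -, hflag⟩ := h
    simp [Test.Holds, NExpr.eval, hflag]
  · obtain ⟨-, -, -, hflag⟩ := h
    simp [Test.Holds, NExpr.eval, hflag]
  · refine ⟨τ, fun _ => firstSet τ k, (hs.frame hf₁ rfl).frame hf₂ rfl,
      ⟨hg, fun t ht => absurd ht (Nat.not_lt_zero t)⟩, rfl, ?_, ?_, h₂⟩
    · rw [hf₂.2 9 rfl, hf₁.2 9 rfl, hcur]
    · rw [hf₂.1 8 rfl, h₁]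
  · simp only [Test.cost, NExpr.cost, sizeExpr]
    have : 1 + (1 + 1) + 1 + (k * (scanCost d.num k + 11) + 60) =
      k * (scanCost d.num k + 11) + 64 := by omega
    rw [this]
    omega

end MainProgram

/-! ### Total cost and the main statement. -/

section Main

variable {m n : ℕ} {A : Matrix (Fin m) (Fin n) ℝ} {k : ℕ} {ε : ℝ}

/-- The enumeration of the entries given by an input; the entry `x₀` is used out of range. -/
noncomputable def entriesOfEquiv (e : Fin (nnz A) ≃ Support A) (x₀ : Support A) : Entries A where
  num := nnz A
  row := fun p => (if h : p < nnz A then e ⟨p, h⟩ else x₀).1.1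
  col := fun p => (if h : p < nnz A then e ⟨p, h⟩ else x₀).1.2
  sum_eq := fun F hF => by
    classical
    rw [Finset.sum_range]
    simp only [Fin.is_lt, dite_true, Fin.eta]
    rw [e.sum_comp (fun x : Support A => F x.1.1 x.1.2),
      ← Fintype.sum_prod_type' (fun i j => F i j),
      ← Finset.sum_filter_of_ne (s := Finset.univ) (p := fun x : Fin m × Fin n => A x.1 x.2 ≠ 0)
        (fun x _ hx h => hx (hF _ _ h))]
    exact (Finset.sum_subtype _ (by simp) (fun x : Fin m × Fin n => F x.1 x.2)).symm

theorem entriesOfEquiv_loaded (e : Fin (nnz A) ≃ Support A) (x₀ : Support A) :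
    (entriesOfEquiv e x₀).Loaded (input A k ε e) where
  num := rfl
  row := fun p hp => by
    have hp' : p < nnz A := hp
    simp [input, entriesOfEquiv, hp']
  col := fun p hp => by
    have hp' : p < nnz A := hp
    simp [input, entriesOfEquiv, hp']
  val := fun p hp => by
    have hp' : p < nnz A := hp
    simp [input, entriesOfEquiv, hp']

/-- A scan costs `O(N k²)`, and each of the at most `M + 1` rounds has `k` scans; `1 ≤ N` and `1 ≤
k` absorb the lower-order terms. -/
theorem cost_le {N k M : ℕ} (hN : 1 ≤ N) (hk : 1 ≤ k) :
    N * 30 + 8 + (k * (scanCost N k + 40) + 8 + ((M + 1) * (k * (scanCost N k + 11) + 64) + 20)) ≤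
      1100 * ((M + 1) * (N * k ^ 3)) := by
  have hk2 : k ≤ k ^ 2 := Nat.le_self_pow (by norm_num) k
  have hk3 : k ^ 2 ≤ k ^ 3 := Nat.pow_le_pow_right hk (by norm_num)
  have hNk : ∀ x, x ≤ N * x := fun x => Nat.le_mul_of_pos_left x hN
  have h1 : scanCost N k ≤ 444 * (N * k ^ 2) := by
    have e : scanCost N k =
        120 * (N * k) + 44 * (N * k ^ 2) + 19 * k ^ 2 + 91 * k + 120 * N + 50 := by
      rw [scanCost]; ring
    have a1 : N * k ≤ N * k ^ 2 := Nat.mul_le_mul_left N hk2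
    have a2 := hNk (k ^ 2)
    have a3 : N ≤ N * k ^ 2 := Nat.le_mul_of_pos_right N (by positivity)
    omega
  set v := N * k ^ 3 with hv
  have b1 : k ≤ v := (hk2.trans hk3).trans (hNk _)
  have b2 : N ≤ v := Nat.le_mul_of_pos_right N (by positivity)
  have b3 : k * scanCost N k ≤ 444 * v := by
    calc k * scanCost N k ≤ k * (444 * (N * k ^ 2)) := Nat.mul_le_mul_left k h1
      _ = 444 * v := by rw [hv]; ring
  have b4 : k * (scanCost N k + 40) ≤ 484 * v := by rw [Nat.mul_add]; omega
  have b5 : k * (scanCost N k + 11) + 64 ≤ 519 * v := by rw [Nat.mul_add]; omega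
  have b6 : (M + 1) * (k * (scanCost N k + 11) + 64) ≤ (M + 1) * (519 * v) :=
    Nat.mul_le_mul_left _ b5
  have b7 : (M + 1) * (519 * v) = 519 * ((M + 1) * v) := by ring
  have b8 : v ≤ (M + 1) * v := Nat.le_mul_of_pos_left v (Nat.succ_pos M)
  omega

/-- Uses `log k ≤ k` and `1 / min ε k ≤ 1 + 1 / ε`, the latter because `k ≥ 1`. -/
theorem steps_add_one_le (hk : 1 ≤ k) (hε : 0 < ε) :
    2 * ((k : ℝ) ^ 2 * Real.log k / min ε (k : ℝ)) + 1 ≤ 3 * (k : ℝ) ^ 3 * (1 + 1 / ε) := by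
  have hk1 : (1 : ℝ) ≤ k := by exact_mod_cast hk
  have hk0 : (0 : ℝ) < k := by linarith
  have hlog : Real.log k ≤ k := (Real.log_le_sub_one_of_pos hk0).trans (by linarith)
  have hinv : 1 / min ε (k : ℝ) ≤ 1 + 1 / ε := by
    have hε' : 0 < 1 / ε := one_div_pos.2 hε
    rcases min_choice ε (k : ℝ) with h | h <;> rw [h]
    · linarith
    · have : 1 / (k : ℝ) ≤ 1 := (div_le_one hk0).2 hk1
      linarith
  have hmin : 0 < min ε (k : ℝ) := lt_min hε hk0
  have h1 : (k : ℝ) ^ 2 * Real.log k / min ε (k : ℝ) ≤ (k : ℝ) ^ 3 * (1 + 1 / ε) := by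
    rw [div_eq_mul_one_div]
    have : (k : ℝ) ^ 2 * Real.log k ≤ (k : ℝ) ^ 3 := by
      rw [pow_succ _ 2]
      exact mul_le_mul_of_nonneg_left hlog (by positivity)
    exact mul_le_mul this hinv (by positivity) (by positivity)
  have h2 : 1 ≤ (k : ℝ) ^ 3 * (1 + 1 / ε) := by
    have h3 : 1 ≤ (k : ℝ) ^ 3 := one_le_pow₀ hk1
    have h4 : 0 < 1 / ε := one_div_pos.2 hε
    nlinarith
  linarith

/-- The program outputs a result of the algorithm in time linear in the number of entries. -/
theorem exec_mapProg (hk : 1 ≤ k) (hr : k ≤ A.rank) (hε : 0 < ε)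
    (e : Fin (nnz A) ≃ Support A) :
    ∃ (T : ℕ) (s : Mem) (S : Finset (Fin m)), Exec mapProg (input A k ε e) T s ∧
      Outputs s k S ∧ IsResult A k ε S ∧
      (T : ℝ) ≤ (3300 : ℕ) * (k : ℝ) ^ 6 * (1 + 1 / ε) * (nnz A : ℝ) := by
  -- Positive rank provides an entry, which serves as the value out of range and gives `nnz A ≥ 1`.
  obtain ⟨x₀⟩ : Nonempty (Support A) := by
    by_contra hne
    have : A = 0 := by
      ext i j
      by_contra h
      exact hne ⟨⟨(i, j), h⟩⟩
    rw [this, rank_zero] at hr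
    omega
  have hN : 1 ≤ nnz A := Finite.card_pos_iff.2 ⟨x₀⟩
  set M := ⌊2 * ((k : ℝ) ^ 2 * Real.log k / min ε (k : ℝ))⌋₊ with hMdef
  have hM : ∀ N R, IsRun A k ε N R → N ≤ M := fun N R h => Nat.le_floor (h.length_le hε hk)
  set d := entriesOfEquiv e x₀ with hd
  have hl : d.Loaded (input A k ε e) := entriesOfEquiv_loaded e x₀
  have hrun : Run mapProg (input A k ε e) (d.num * 30 + 8 + (k * (scanCost d.num k + 40) + 8 +
      ((M + 1) * (k * (scanCost d.num k + 11) + 64) + 20))) (Entries.Stopped A k ε) := by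
    refine Run.seq (run_scatter hl fun i j => by simp [input]) fun s₁ hf₁ h₁ =>
      Run.seq (run_greedyProg (τ := fun _ => x₀.1.1) (ε := ε) hr ?_) ?_
    · exact ⟨hl.congr (hf₁.1 0 rfl) (hf₁.1 1 rfl) (hf₁.1 2 rfl) (hf₁.2 1 rfl),
        by rw [hf₁.1 0 rfl]; rfl, by rw [hf₁.2 0 rfl]; simp [input], h₁,
        fun a ha => absurd ha (Nat.not_lt_zero a), fun l h => absurd h (Nat.not_lt_zero l),
        fun l h => absurd h (Nat.not_lt_zero l)⟩
    · rintro s₂ - ⟨τ, hτ, hg, hcur⟩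
      exact run_localProg hε hM hτ hg (hcur.resolve_left (by omega))
  obtain ⟨T, s, hT, hle, τ, hsel, hres, -⟩ := hrun
  refine ⟨T, s, firstSet τ k, hT, ⟨fun t ht => ⟨τ t, mem_firstSet.2 ⟨t, ht, rfl⟩, hsel t ht⟩,
    fun i hi => ?_⟩, hres, ?_⟩
  · obtain ⟨t, ht, rfl⟩ := mem_firstSet.1 hi
    exact ⟨t, ht, hsel t ht⟩
  · have h1 : T ≤ 1100 * ((M + 1) * (nnz A * k ^ 3)) := hle.trans (cost_le hN hk)
    have h2 : (T : ℝ) ≤ 1100 * (((M : ℝ) + 1) * ((nnz A : ℝ) * (k : ℝ) ^ 3)) := by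
      exact_mod_cast h1
    -- One factor `k ^ 3` comes from the number of rounds and one from their cost, whence the
    -- exponent `6` and the constant `3 * 1100`.
    have h3 : (M : ℝ) + 1 ≤ 3 * (k : ℝ) ^ 3 * (1 + 1 / ε) := by
      refine le_trans (add_le_add_left (Nat.floor_le ?_) 1) (steps_add_one_le hk hε)
      have hlog := Real.log_natCast_nonneg k
      positivity
    refine h2.trans ?_
    calc 1100 * (((M : ℝ) + 1) * ((nnz A : ℝ) * (k : ℝ) ^ 3))
        ≤ 1100 * ((3 * (k : ℝ) ^ 3 * (1 + 1 / ε)) * ((nnz A : ℝ) * (k : ℝ) ^ 3)) := by gcongr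
      _ = _ := by push_cast; ring

end Main

end MAPkDPP

theorem theorem4p1 :
    -- Number of local search steps and approximation guarantee.
    (∃ C : ℝ, 0 < C ∧
      ∀ (m n : ℕ) (A : Matrix (Fin m) (Fin n) ℝ) (k : ℕ) (ε : ℝ), 1 ≤ k → k ≤ m → 0 < ε →
        (∃ S : Finset (Fin m), MAPkDPP.IsResult A k ε S) ∧
        (∀ (N : ℕ) (R : ℕ → Finset (Fin m)), MAPkDPP.IsRun A k ε N R →
          (N : ℝ) ≤ C * ((k : ℝ) ^ 2 * Real.log k / min ε (k : ℝ))) ∧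
        (∀ S : Finset (Fin m), MAPkDPP.IsResult A k ε S →
          S.card = k ∧
          ∀ T : Finset (Fin m), T.card = k →
            MAPkDPP.detRows A T ≤
              (2 : ℝ) ^ ((k : ℝ) * Real.logb 2 (min (k : ℝ) (MAPkDPP.kappa A k))) *
                MAPkDPP.detRows A S)) ∧
    -- Comparison with the condition number.
    (∀ (m n : ℕ) (A : Matrix (Fin m) (Fin n) ℝ) (k : ℕ), 1 ≤ k → k ≤ m →
      0 < MAPkDPP.lam A m →
        MAPkDPP.kappa A k ≤ MAPkDPP.lam A 1 / MAPkDPP.lam A m) ∧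
    -- Running time: one program for all inputs, linear in the number of non-zero entries.
    (∃ (P : MAPkDPP.Prog) (C d : ℕ),
      ∀ (m n : ℕ) (A : Matrix (Fin m) (Fin n) ℝ) (k : ℕ) (ε : ℝ), 1 ≤ k → k ≤ A.rank → 0 < ε →
        ∀ e : Fin (MAPkDPP.nnz A) ≃ MAPkDPP.Support A,
          ∃ (T : ℕ) (s : MAPkDPP.Mem) (S : Finset (Fin m)),
            MAPkDPP.Exec P (MAPkDPP.input A k ε e) T s ∧
            MAPkDPP.Outputs s k S ∧
            MAPkDPP.IsResult A k ε S ∧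
            (T : ℝ) ≤ (C : ℝ) * (k : ℝ) ^ d * (1 + 1 / ε) * (MAPkDPP.nnz A : ℝ)) := by
  refine ⟨⟨2, two_pos, fun m n A k ε hk hkm hε => ⟨MAPkDPP.exists_isResult A hk hkm hε,
    fun N R h => h.length_le hε hk,
    fun S h => ⟨h.card_eq, fun T hT => h.detRows_le hk hkm hε hT⟩⟩⟩,
    fun m n A k hk hkm h => MAPkDPP.kappa_le hk hkm h,
    ⟨MAPkDPP.mapProg, 3300, 6, fun m n A k ε hk hr hε e => MAPkDPP.exec_mapProg hk hr hε e⟩⟩
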